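/- **Setting.** Let $(X,d)$ be a complete separable metric space and let $m\ge 0$ be a Borel measure on $X$ that is finite on balls. Let $W^{1,2}(X)$ be the Sobolev space of $f\in L^2(m)$ having a (2-)weak upper gradient in $L^2(m)$, with $\|f\|^2=\int |f|^2+|Df|^2\,dm$, where $|Df|$ is the minimal weak upper gradient. For $E\subset X$ let $\mathrm{Cap}(E)=\inf\|f\|^2$ over all $f\in W^{1,2}(X)$ with $f\ge 1$ $m$-a.e. on an open neighbourhood of $E$; this is an outer measure with $m\le\mathrm{Cap}$. For $\mu\in\{\mathrm{Cap},m\}$ let $L^0(\mu)$ be the ring of Borel functions $X\to\mathbb R$ modulo equality outside a $\mu$-null set, and let $\mathrm{Pr}:L^0(\mathrm{Cap})\to L^0(m)$, $[f]_{\mathrm{Cap}}\mapsto[f]_m$. Put $\int f\,d\mu=\int_0^\infty\mu(\{f>t\})\,dt$ for $f\ge0$. Fix an increasing sequence $(A_k)_{k\in\mathbb N}$ of open sets of finite capacity such that every bounded set is contained in some $A_k$. An *$L^0(\mu)$-module* is a real topological vector space $\mathscr M$ with a bilinear action of $L^0(\mu)$ satisfying $f(gv)=(fg)v$ and $1v=v$,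 and a pointwise norm $|\cdot|:\mathscr M\to L^0(\mu)$ such that, $\mu$-a.e., $|v|\ge 0$ with equality iff $v=0$, $|v+w|\le|v|+|w|$ and $|fv|=|f||v|$, and such that the distance $$d_{\mathscr M}(v,w)=\sum_k\frac{1}{2^k(\mu(A_k)\vee1)}\int_{A_k}|v-w|\wedge 1\,d\mu$$ is complete and induces the topology. Let $\mathscr M$ be an $L^0(\mathrm{Cap})$-module, let $\mathscr M_m$ be its quotient by the relation $v\sim w\iff |v-w|=0$ $m$-a.e., and let $\mathrm{Pr}_{\mathscr M}:\mathscr M\to\mathscr M_m$, $v\mapsto[v]_m$, be the projection. Equip $\mathscr M_m$ with the operations $[v]_m+[w]_m=[v+w]_m$, $[f]_m[v]_m=[[f]_{\mathrm{Cap}}v]_m$, the pointwise norm $|[v]_m|=\mathrm{Pr}(|v|)$, and the topology of the distance $d_{\mathscr M_m}$. **Statement.** 1. $\mathscr M_m$ is an $L^0(m)$-module. 2. For every $L^0(m)$-module $\mathscr N$ and every ($\mathbb R$-)linear $T:\mathscr M\to\mathscr N$ with $|T(v)|\le\mathrm{Pr}(|v|)$ $m$-a.e. for all $v\in\mathscr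 M$, there is a unique continuous $L^0(m)$-linear map $S:\mathscr M_m\to\mathscr N$ with $S\circ\mathrm{Pr}_{\mathscr M}=T$. Moreover $|S(x)|\le|x|$ $m$-a.e. for all $x\in\mathscr M_m$. 3. Let $\mathscr M'$ be an $L^0(m)$-module and $\mathrm{Pr}':\mathscr M\to\mathscr M'$ a linear map with $|\mathrm{Pr}'(v)|\le\mathrm{Pr}(|v|)$ $m$-a.e. for all $v$. (a) If every $T$ as in 2 factors through $\mathrm{Pr}'$ by a unique continuous $L^0(m)$-linear map $\mathscr M'\to\mathscr N$, then there is a unique $L^0(m)$-linear homeomorphism $\Phi:\mathscr M_m\to\mathscr M'$ with $\Phi\circ\mathrm{Pr}_{\mathscr M}=\mathrm{Pr}'$. (b) If in addition the factorising maps $S$ always satisfy $|S(x)|\le|x|$, or if in addition $|\mathrm{Pr}'(v)|=\mathrm{Pr}(|v|)$ for all $v$, then there is a unique isomorphism of $L^0(m)$-modules $\Phi:\mathscr M_m\to\mathscr M'$ (an $L^0(m)$-linear homeomorphism preserving the pointwise norm) with $\Phi\circ\mathrm{Pr}_{\mathscr M}=\mathrm{Pr}'$. -/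

import Mathlib

open MeasureTheory Filter Topology Set
open scoped ENNReal

noncomputable section

namespace CapModule

/-! ### Integration with respect to an outer measure -/

/-- Cavalieri's formula `∫ f dμ = ∫₀^∞ μ {f > t} dt`, for an outer measure `μ` and an arbitrary
function `f ≥ 0`. -/
def outerIntegral {X : Type*} (μ : OuterMeasure X) (f : X → ℝ≥0∞) : ℝ≥0∞ :=
  ∫⁻ t in Ioi (0 : ℝ), μ {x | ENNReal.ofReal t < f x}

/-- `∫_E f dμ = ∫ χ_E f dμ`. -/
def outerSetIntegral {X : Type*} (μ : OuterMeasure X) (E : Set X) (f : X → ℝ≥0∞) : ℝ≥0∞ :=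
  outerIntegral μ (E.indicator f)

/-- For a measure, Cavalieri's formula gives the usual Lebesgue integral. -/
theorem outerIntegral_toOuterMeasure {X : Type*} [MeasurableSpace X] (m : Measure X)
    {f : X → ℝ} (hf : Measurable f) (h0 : 0 ≤ f) :
    outerIntegral m.toOuterMeasure (fun x => ENNReal.ofReal (f x))
      = ∫⁻ x, ENNReal.ofReal (f x) ∂m := by
  rw [lintegral_eq_lintegral_meas_lt m (Eventually.of_forall h0) hf.aemeasurable, outerIntegral]
  refine setLIntegral_congr_fun measurableSet_Ioi fun t ht => ?_
  have : {x | ENNReal.ofReal t < ENNReal.ofReal (f x)} = {x | t < f x} := by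
    ext x
    simp only [mem_ofPred_eq]
    exact ENNReal.ofReal_lt_ofReal_iff_of_nonneg (le_of_lt ht)
  simp only [this, Measure.coe_toOuterMeasure]

/-! ### Sobolev functions and capacity on a metric measure space -/

section Sobolev

variable {X : Type*} [MetricSpace X] [MeasurableSpace X]

/-- `G` is a (2-)weak upper gradient of (the `m`-a.e. class of) `f`: for some representative `f'`,
`|f' (γ L) - f' (γ 0)| ≤ ∫_γ G` for every rectifiable curve `γ`, parametrised by arc length on
`[0, L]`, outside a family of curves of zero 2-modulus, i.e. a family of curves along each of
which one fixed Borel `ρ ∈ L²(m)` has infinite integral. -/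
def IsWeakUpperGradient (m : Measure X) (f : X → ℝ) (G : X → ℝ≥0∞) : Prop :=
  Measurable G ∧ ∃ f' : X → ℝ, f' =ᵐ[m] f ∧
    ∃ ρ : X → ℝ≥0∞, Measurable ρ ∧ ∫⁻ x, ρ x ^ 2 ∂m < ∞ ∧
      ∀ (L : ℝ) (γ : ℝ → X), 0 ≤ L → HasUnitSpeedOn γ (Icc 0 L) →
        ∫⁻ t in Icc 0 L, ρ (γ t) = ∞ ∨
          ENNReal.ofReal |f' (γ L) - f' (γ 0)| ≤ ∫⁻ t in Icc 0 L, G (γ t)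

/-- `‖f‖²` in `W^{1,2}`: the squared `L²(m)`-norm of `f` plus that of its minimal weak upper
gradient, that is, plus the least squared `L²(m)`-norm of a weak upper gradient of `f`
(`∞` if there is none in `L²(m)`). -/
def sobolevNormSq (m : Measure X) (f : X → ℝ) : ℝ≥0∞ :=
  ∫⁻ x, ENNReal.ofReal (f x ^ 2) ∂m +
    ⨅ (G : X → ℝ≥0∞) (_ : IsWeakUpperGradient m f G), ∫⁻ x, G x ^ 2 ∂m

/-- `f` is (a representative of) an element of `W^{1,2}(X, d, m)`. -/
def MemW12 (m : Measure X) (f : X → ℝ) : Prop :=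
  AEMeasurable f m ∧ sobolevNormSq m f < ∞

/-- The functions in `W^{1,2}` which are `≥ 1` a.e. on some open neighbourhood of `E`. -/
def capAdmissible (m : Measure X) (E : Set X) : Set (X → ℝ) :=
  {f | MemW12 m f ∧ ∃ U, IsOpen U ∧ E ⊆ U ∧ ∀ᵐ x ∂m, x ∈ U → 1 ≤ f x}

/-- The capacity as a set function, `inf ‖f‖²` over admissible `f` (`∞` if there are none). -/
def capFun (m : Measure X) (E : Set X) : ℝ≥0∞ :=
  ⨅ f ∈ capAdmissible m E, sobolevNormSq m f

theorem capFun_mono (m : Measure X) {E F : Set X} (h : E ⊆ F) : capFun m E ≤ capFun m F := by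
  refine le_iInf₂ fun f hf => iInf₂_le f ⟨hf.1, ?_⟩
  obtain ⟨U, hU, hFU, h1⟩ := hf.2
  exact ⟨U, hU, h.trans hFU, h1⟩

theorem capFun_empty (m : Measure X) : capFun m ∅ = 0 := by
  have h0 : IsWeakUpperGradient m (fun _ => (0 : ℝ)) (fun _ => 0) :=
    ⟨measurable_const, fun _ => 0, EventuallyEq.rfl, fun _ => 0, measurable_const, by simp,
      fun L γ _ _ => Or.inr (by simp)⟩
  have hs : sobolevNormSq m (fun _ => (0 : ℝ)) = 0 := by
    have : (⨅ (G : X → ℝ≥0∞) (_ : IsWeakUpperGradient m (fun _ => (0 : ℝ)) G),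
        ∫⁻ x, G x ^ 2 ∂m) = 0 :=
      le_antisymm ((iInf₂_le _ h0).trans (by simp)) bot_le
    simp [sobolevNormSq, this]
  refine le_antisymm ?_ bot_le
  rw [← hs]
  exact iInf₂_le _ ⟨⟨aemeasurable_const, by simp [hs]⟩, ∅, isOpen_empty, subset_rfl, by simp⟩

/-- A nearly optimal admissible function together with a weak upper gradient. -/
theorem exists_admissible_of_capFun_lt (m : Measure X) {E : Set X} {c : ℝ≥0∞}
    (h : capFun m E < c) :
    ∃ (f : X → ℝ) (G : X → ℝ≥0∞), AEMeasurable f m ∧ IsWeakUpperGradient m f G ∧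
      (∃ U, IsOpen U ∧ E ⊆ U ∧ ∀ᵐ x ∂m, x ∈ U → 1 ≤ f x) ∧
      ∫⁻ x, ENNReal.ofReal (f x ^ 2) ∂m + ∫⁻ x, G x ^ 2 ∂m < c := by
  simp only [capFun, iInf_lt_iff] at h
  obtain ⟨f, hf, hlt⟩ := h
  rw [sobolevNormSq, ENNReal.add_iInf] at hlt
  simp only [iInf_lt_iff] at hlt
  obtain ⟨G, hG⟩ := hlt
  by_cases hw : IsWeakUpperGradient m f G
  · exact ⟨f, G, hf.1.1, hw, hf.2, by simpa [hw] using hG⟩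
  · simp [hw] at hG

theorem capFun_le_of (m : Measure X) {E : Set X} {f : X → ℝ} {G : X → ℝ≥0∞}
    (hf : AEMeasurable f m) (hG : IsWeakUpperGradient m f G)
    (hU : ∃ U, IsOpen U ∧ E ⊆ U ∧ ∀ᵐ x ∂m, x ∈ U → 1 ≤ f x) :
    capFun m E ≤ ∫⁻ x, ENNReal.ofReal (f x ^ 2) ∂m + ∫⁻ x, G x ^ 2 ∂m := by
  have hle : sobolevNormSq m f ≤ ∫⁻ x, ENNReal.ofReal (f x ^ 2) ∂m + ∫⁻ x, G x ^ 2 ∂m :=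
    add_le_add le_rfl (iInf₂_le _ hG)
  rcases eq_or_ne (sobolevNormSq m f) ∞ with h | h
  · rw [h] at hle
    exact le_top.trans hle
  · exact (iInf₂_le f ⟨⟨hf, h.lt_top⟩, hU⟩).trans hle

theorem abs_iSup_sub_iSup_le {a b : ℕ → ℝ} (ha : ∀ n, a n ∈ Icc (0 : ℝ) 1)
    (hb : ∀ n, b n ∈ Icc (0 : ℝ) 1) {c : ℝ} (h : ∀ n, |a n - b n| ≤ c) :
    |(⨆ n, a n) - ⨆ n, b n| ≤ c := by
  have hA : BddAbove (range a) := ⟨1, by rintro _ ⟨n, rfl⟩; exact (ha n).2⟩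
  have hB : BddAbove (range b) := ⟨1, by rintro _ ⟨n, rfl⟩; exact (hb n).2⟩
  rw [abs_le]
  constructor
  · have : (⨆ n, b n) ≤ (⨆ n, a n) + c := ciSup_le fun n => by
      have := (abs_le.1 (h n)).1
      have := le_ciSup hA n
      linarith
    linarith
  · have : (⨆ n, a n) ≤ (⨆ n, b n) + c := ciSup_le fun n => by
      have := (abs_le.1 (h n)).2
      have := le_ciSup hB n
      linarith
    linarith

/-- Truncation to `[0, 1]`. -/
def trunc (a : ℝ) : ℝ := max 0 (min a 1)

theorem trunc_mem (a : ℝ) : trunc a ∈ Icc (0 : ℝ) 1 :=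
  ⟨le_max_left _ _, max_le zero_le_one (min_le_right _ _)⟩

theorem abs_trunc_sub_le (a b : ℝ) : |trunc a - trunc b| ≤ |a - b| := by
  have h1 := abs_max_sub_max_le_max 0 (min a 1) 0 (min b 1)
  have h2 := abs_min_sub_min_le_max a 1 b 1
  simp only [sub_self, abs_zero] at h1 h2
  exact (h1.trans (max_le (abs_nonneg _) le_rfl)).trans (h2.trans (max_le le_rfl (abs_nonneg _)))

theorem trunc_sq_le (a : ℝ) : trunc a ^ 2 ≤ a ^ 2 := by
  rw [← sq_abs (trunc a), ← sq_abs a]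
  have := abs_trunc_sub_le a 0
  simp only [trunc, zero_le_one, min_eq_left, max_self, sub_zero] at this
  exact pow_le_pow_left₀ (abs_nonneg _) this 2

theorem sq_iSup_le_tsum (a : ℕ → ℝ≥0∞) : (⨆ n, a n) ^ 2 ≤ ∑' n, a n ^ 2 := by
  rw [ENNReal.iSup_pow]
  exact iSup_le fun n => ENNReal.le_tsum n

theorem lintegral_sq_iSup_le {Y : Type*} [MeasurableSpace Y] (m : Measure Y) {G : ℕ → Y → ℝ≥0∞} (hG : ∀ n, Measurable (G n)) :
    ∫⁻ x, (⨆ n, G n x) ^ 2 ∂m ≤ ∑' n, ∫⁻ x, G n x ^ 2 ∂m := by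
  rw [← lintegral_tsum fun n => ((hG n).pow_const 2).aemeasurable]
  exact lintegral_mono fun x => sq_iSup_le_tsum _

/-- The supremum of truncated functions has the supremum of the gradients as a weak upper
gradient. -/
theorem IsWeakUpperGradient.iSup_trunc {m : Measure X} {f : ℕ → X → ℝ} {G : ℕ → X → ℝ≥0∞}
    (h : ∀ n, IsWeakUpperGradient m (f n) (G n)) :
    IsWeakUpperGradient m (fun x => ⨆ n, trunc (f n x)) (fun x => ⨆ n, G n x) := by
  refine ⟨Measurable.iSup fun n => (h n).1, ?_⟩
  choose hG f' hf' ρ hρ hfin hγ using h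
  refine ⟨fun x => ⨆ n, trunc (f' n x), ?_, ?_⟩
  · filter_upwards [ae_all_iff.2 hf'] with x hx
    simp only [hx]
  obtain ⟨δ, hδ, hsum⟩ := ENNReal.exists_pos_tsum_mul_lt_of_countable (ε := 1) one_ne_zero
    (fun n => ∫⁻ x, ρ n x ^ 2 ∂m) (fun n => (hfin n).ne)
  have hmeas : ∀ n, Measurable fun x => (NNReal.sqrt (δ n) : ℝ≥0∞) * ρ n x :=
    fun n => (hρ n).const_mul _
  refine ⟨fun x => ⨆ n, (NNReal.sqrt (δ n) : ℝ≥0∞) * ρ n x, Measurable.iSup hmeas, ?_, ?_⟩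
  · refine (lintegral_sq_iSup_le m hmeas).trans_lt (lt_of_le_of_lt ?_ (hsum.trans ENNReal.one_lt_top))
    refine ENNReal.tsum_le_tsum fun n => ?_
    simp only [mul_pow]
    rw [lintegral_const_mul _ ((hρ n).pow_const 2), mul_comm, ← ENNReal.coe_pow, NNReal.sq_sqrt]
  · intro L γ hL hs
    by_cases hex : ∃ n, ∫⁻ t in Icc 0 L, ρ n (γ t) = ∞
    · obtain ⟨n, hn⟩ := hex
      left
      refine top_le_iff.1 ?_
      calc ∞ = (NNReal.sqrt (δ n) : ℝ≥0∞) * ∫⁻ t in Icc 0 L, ρ n (γ t) := by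
            rw [hn, ENNReal.mul_top]
            simpa using (hδ n).ne'
        _ ≤ ∫⁻ t in Icc 0 L, (NNReal.sqrt (δ n) : ℝ≥0∞) * ρ n (γ t) := lintegral_const_mul_le _ _
        _ ≤ _ := lintegral_mono fun t =>
            le_iSup (fun n => (NNReal.sqrt (δ n) : ℝ≥0∞) * ρ n (γ t)) n
    · right
      simp only [not_exists] at hex
      rcases eq_or_ne (∫⁻ t in Icc 0 L, ⨆ n, G n (γ t)) ∞ with htop | htop
      · rw [htop]
        exact le_top
      rw [ENNReal.ofReal_le_iff_le_toReal htop]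
      refine abs_iSup_sub_iSup_le (fun n => trunc_mem _) (fun n => trunc_mem _) fun n => ?_
      refine (abs_trunc_sub_le _ _).trans ?_
      rw [← ENNReal.ofReal_le_iff_le_toReal htop]
      exact ((hγ n L γ hL hs).resolve_left (hex n)).trans
        (lintegral_mono fun t => le_iSup (fun n => G n (γ t)) n)

theorem capFun_iUnion_le (m : Measure X) (E : ℕ → Set X) :
    capFun m (⋃ n, E n) ≤ ∑' n, capFun m (E n) := by
  refine ENNReal.le_of_forall_pos_le_add fun ε hε hfin => ?_
  obtain ⟨δ, hδ, hsum⟩ := ENNReal.exists_pos_sum_of_countable' (ENNReal.coe_pos.2 hε).ne' ℕ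
  have hlt : ∀ n, capFun m (E n) < capFun m (E n) + δ n := fun n =>
    ENNReal.lt_add_right (ENNReal.ne_top_of_tsum_ne_top hfin.ne n) (hδ n).ne'
  choose f G hf hG hU hle using fun n => exists_admissible_of_capFun_lt m (hlt n)
  choose U hUo hEU hUf using hU
  have hmt : Measurable trunc := by
    unfold trunc
    fun_prop
  have hmeas : ∀ n, AEMeasurable (fun x => trunc (f n x)) m := fun n =>
    hmt.comp_aemeasurable (hf n)
  have hbdd : ∀ x, BddAbove (range fun n => trunc (f n x)) := fun x =>
    ⟨1, by rintro _ ⟨n, rfl⟩; exact (trunc_mem _).2⟩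
  have hadm := capFun_le_of m (E := ⋃ n, E n) (AEMeasurable.iSup hmeas)
    (IsWeakUpperGradient.iSup_trunc hG) ⟨⋃ n, U n, isOpen_iUnion hUo, iUnion_mono hEU, by
      filter_upwards [ae_all_iff.2 hUf] with x hx hxU
      obtain ⟨n, hn⟩ := mem_iUnion.1 hxU
      refine le_trans ?_ (le_ciSup (hbdd x) n)
      exact le_max_of_le_right (le_min (hx n hn) le_rfl)⟩
  have h1 : ∫⁻ x, ENNReal.ofReal ((⨆ n, trunc (f n x)) ^ 2) ∂m
      ≤ ∑' n, ∫⁻ x, ENNReal.ofReal (f n x ^ 2) ∂m := by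
    rw [← lintegral_tsum fun n => ((hf n).pow_const 2).ennreal_ofReal]
    refine lintegral_mono fun x => ?_
    rw [Real.iSup_pow fun n => (trunc_mem (f n x)).1]
    have hb : ∀ n, trunc (f n x) ^ 2 ≤ 1 := fun n =>
      pow_le_one₀ (trunc_mem _).1 (trunc_mem _).2
    rcases eq_or_ne (∑' n, ENNReal.ofReal (f n x ^ 2)) ∞ with ht | ht
    · simp only [ht, le_top]
    simp only
    rw [ENNReal.ofReal_le_iff_le_toReal ht]
    refine ciSup_le fun n => (trunc_sq_le _).trans ?_
    rw [← ENNReal.ofReal_le_iff_le_toReal ht]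
    exact ENNReal.le_tsum n
  calc capFun m (⋃ n, E n)
      ≤ ∑' n, ∫⁻ x, ENNReal.ofReal (f n x ^ 2) ∂m + ∑' n, ∫⁻ x, G n x ^ 2 ∂m :=
        hadm.trans (add_le_add h1 (lintegral_sq_iSup_le m fun n => (hG n).1))
    _ = ∑' n, (∫⁻ x, ENNReal.ofReal (f n x ^ 2) ∂m + ∫⁻ x, G n x ^ 2 ∂m) :=
        ENNReal.tsum_add.symm
    _ ≤ ∑' n, (capFun m (E n) + δ n) := ENNReal.tsum_le_tsum fun n => (hle n).le
    _ = ∑' n, capFun m (E n) + ∑' n, δ n := ENNReal.tsum_add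
    _ ≤ ∑' n, capFun m (E n) + ε := add_le_add le_rfl hsum.le

/-- The capacity, as an outer measure. -/
def cap (m : Measure X) : OuterMeasure X where
  measureOf := capFun m
  empty := capFun_empty m
  mono := capFun_mono m
  iUnion_nat E _ := capFun_iUnion_le m E

theorem measure_le_cap [BorelSpace X] (m : Measure X) (E : Set X) : m E ≤ cap m E := by
  refine le_iInf₂ fun f hf => ?_
  obtain ⟨U, hU, hEU, h1⟩ := hf.2
  calc m E ≤ m U := measure_mono hEU
    _ = ∫⁻ x in U, 1 ∂m := by simp
    _ ≤ ∫⁻ x in U, ENNReal.ofReal (f x ^ 2) ∂m := by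
        refine lintegral_mono_ae ((ae_restrict_iff' hU.measurableSet).2 ?_)
        filter_upwards [h1] with x hx hxU
        exact ENNReal.one_le_ofReal.2 (one_le_pow₀ (hx hxU))
    _ ≤ ∫⁻ x, ENNReal.ofReal (f x ^ 2) ∂m := setLIntegral_le_lintegral _ _
    _ ≤ sobolevNormSq m f := le_self_add

end Sobolev

/-! ### The spaces `L⁰(μ)` -/

section L0

variable {X : Type*} [MeasurableSpace X]

/-- The ring of classes, up to `μ`-a.e. equality (`μ {f ≠ g} = 0`), of Borel functions. -/
def borelGerms (μ : OuterMeasure X) : Subring (Germ (ae μ) ℝ) where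
  carrier := {F | ∃ f : X → ℝ, Measurable f ∧ (f : Germ (ae μ) ℝ) = F}
  mul_mem' := by
    rintro _ _ ⟨f, hf, rfl⟩ ⟨g, hg, rfl⟩
    exact ⟨f * g, hf.mul hg, rfl⟩
  one_mem' := ⟨1, measurable_one, rfl⟩
  add_mem' := by
    rintro _ _ ⟨f, hf, rfl⟩ ⟨g, hg, rfl⟩
    exact ⟨f + g, hf.add hg, rfl⟩
  zero_mem' := ⟨0, measurable_zero, rfl⟩
  neg_mem' := by
    rintro _ ⟨f, hf, rfl⟩
    exact ⟨-f, hf.neg, rfl⟩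

/-- `L⁰(μ)`: Borel functions `X → ℝ` up to `μ`-a.e. equality, with the pointwise operations and
the `μ`-a.e. order. It is used for `μ = Cap` and for `μ` a measure. -/
def L0 (μ : OuterMeasure X) : Type _ := borelGerms μ

namespace L0

variable {μ ν : OuterMeasure X}

instance instCommRing (μ : OuterMeasure X) : CommRing (L0 μ) :=
  inferInstanceAs (CommRing (borelGerms μ))

instance instPartialOrder (μ : OuterMeasure X) : PartialOrder (L0 μ) :=
  inferInstanceAs (PartialOrder (borelGerms μ))

/-- The class of a Borel function. -/
def mk (μ : OuterMeasure X) (f : X → ℝ) (hf : Measurable f) : L0 μ := ⟨f, f, hf, rfl⟩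

theorem exists_mk (F : L0 μ) : ∃ f hf, mk μ f hf = F := by
  obtain ⟨_, f, hf, rfl⟩ := F
  exact ⟨f, hf, rfl⟩

theorem mk_eq_mk {f g : X → ℝ} {hf : Measurable f} {hg : Measurable g} :
    mk μ f hf = mk μ g hg ↔ f =ᵐ[μ] g :=
  Subtype.ext_iff.trans Germ.coe_eq

theorem mk_le_mk {f g : X → ℝ} {hf : Measurable f} {hg : Measurable g} :
    mk μ f hf ≤ mk μ g hg ↔ f ≤ᵐ[μ] g :=
  Iff.rfl

/-- A Borel representative. -/
def rep (F : L0 μ) : X → ℝ := F.exists_mk.choose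

theorem measurable_rep (F : L0 μ) : Measurable F.rep := F.exists_mk.choose_spec.choose

theorem mk_rep (F : L0 μ) : mk μ F.rep F.measurable_rep = F := F.exists_mk.choose_spec.choose_spec

/-- Real constants embed in `L⁰(μ)`, making it an `ℝ`-algebra. -/
instance instAlgebra (μ : OuterMeasure X) : Algebra ℝ (L0 μ) :=
  RingHom.toAlgebra
    { toFun := fun c => mk μ (fun _ => c) measurable_const
      map_one' := rfl
      map_mul' := fun _ _ => rfl
      map_zero' := rfl
      map_add' := fun _ _ => rfl }

/-- The pointwise absolute value. -/
def abs (F : L0 μ) : L0 μ :=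
  ⟨F.1.map fun a => |a|, by
    obtain ⟨_, f, hf, rfl⟩ := F
    exact ⟨fun x => |f x|, by simpa using hf.norm, rfl⟩⟩

theorem abs_mk (f : X → ℝ) (hf : Measurable f) :
    abs (mk μ f hf) = mk μ (fun x => |f x|) (by simpa using hf.norm) := rfl

/-- If `μ`-null sets are `ν`-null, the map `[f]_μ ↦ [f]_ν`. -/
def proj (h : ae ν ≤ ae μ) : L0 μ →+* L0 ν where
  toFun F := ⟨F.1.compTendsto id h, by
    obtain ⟨_, f, hf, rfl⟩ := F
    exact ⟨f, hf, rfl⟩⟩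
  map_one' := rfl
  map_zero' := rfl
  map_mul' F G := by
    obtain ⟨f, hf, rfl⟩ := F.exists_mk
    obtain ⟨g, hg, rfl⟩ := G.exists_mk
    rfl
  map_add' F G := by
    obtain ⟨f, hf, rfl⟩ := F.exists_mk
    obtain ⟨g, hg, rfl⟩ := G.exists_mk
    rfl

theorem proj_mk (h : ae ν ≤ ae μ) (f : X → ℝ) (hf : Measurable f) :
    proj h (mk μ f hf) = mk ν f hf := rfl

theorem proj_surjective (h : ae ν ≤ ae μ) : Function.Surjective (proj h) := fun F => by
  obtain ⟨f, hf, rfl⟩ := F.exists_mk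
  exact ⟨mk μ f hf, rfl⟩

theorem proj_mono (h : ae ν ≤ ae μ) {F G : L0 μ} (hFG : F ≤ G) : proj h F ≤ proj h G := by
  obtain ⟨f, hf, rfl⟩ := F.exists_mk
  obtain ⟨g, hg, rfl⟩ := G.exists_mk
  exact h hFG

theorem proj_abs (h : ae ν ≤ ae μ) (F : L0 μ) : proj h F.abs = (proj h F).abs := by
  obtain ⟨f, hf, rfl⟩ := F.exists_mk
  rfl

theorem abs_zero : abs (0 : L0 μ) = 0 := by
  change abs (mk μ (fun _ => (0 : ℝ)) measurable_const) = mk μ (fun _ => (0 : ℝ)) measurable_const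
  rw [abs_mk]
  simp

end L0

end L0

/-! ### The projection `Pr : L⁰(Cap) → L⁰(m)` -/

section Pr

variable {X : Type*} [MetricSpace X] [MeasurableSpace X] [BorelSpace X]

theorem ae_le_ae_cap (m : Measure X) : ae m.toOuterMeasure ≤ ae (cap m) := fun s hs => by
  have hs' : cap m sᶜ = 0 := hs
  exact le_antisymm ((measure_le_cap m _).trans_eq hs') bot_le

/-- `Pr : L⁰(Cap) → L⁰(m)`, `[f]_Cap ↦ [f]_m`. -/
def Pr (m : Measure X) : L0 (cap m) →+* L0 m.toOuterMeasure := L0.proj (ae_le_ae_cap m)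

end Pr

/-! ### Normed modules -/

section Modules

variable {X : Type*} [MeasurableSpace X]

/-- A pointwise norm on an `L⁰(μ)`-module, with values in `L⁰(μ)`. -/
class PointwiseNorm (μ : OuterMeasure X) (M : Type*) [AddCommGroup M] [Module (L0 μ) M] where
  /-- the pointwise norm -/
  pnorm : M → L0 μ
  pnorm_nonneg : ∀ v, 0 ≤ pnorm v
  pnorm_eq_zero_iff : ∀ v, pnorm v = 0 ↔ v = 0
  pnorm_add_le : ∀ v w, pnorm (v + w) ≤ pnorm v + pnorm w
  pnorm_smul : ∀ (f : L0 μ) (v : M), pnorm (f • v) = f.abs * pnorm v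

/-- The pointwise norm `|v| ∈ L⁰(μ)`. -/
def pnorm (μ : OuterMeasure X) {M : Type*} [AddCommGroup M] [Module (L0 μ) M]
    [PointwiseNorm μ M] (v : M) : L0 μ := PointwiseNorm.pnorm v

/-- The distance
`d(v, w) = ∑ₖ 2⁻ᵏ (μ(Aₖ) ∨ 1)⁻¹ ∫_{Aₖ} |v - w| ∧ 1 dμ`
(the integral does not depend on the Borel representative of `|v - w|`). -/
def moduleDist (μ : OuterMeasure X) (A : ℕ → Set X) {M : Type*} [AddCommGroup M]
    [Module (L0 μ) M] [PointwiseNorm μ M] (v w : M) : ℝ≥0∞ :=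
  ∑' k : ℕ, outerSetIntegral μ (A k) (fun x => ENNReal.ofReal (min ((pnorm μ (v - w)).rep x) 1)) /
    (2 ^ k * max (μ (A k)) 1)

/-- The topology on a set given by a distance function: `U` is open if it contains a ball around
each of its points. -/
@[reducible]
def topologyOfDist {M : Type*} (d : M → M → ℝ≥0∞) : TopologicalSpace M where
  IsOpen U := ∀ v ∈ U, ∃ ε, 0 < ε ∧ {w | d v w < ε} ⊆ U
  isOpen_univ := fun _ _ => ⟨1, one_pos, subset_univ _⟩
  isOpen_inter := fun U V hU hV v hv => by
    obtain ⟨ε, hε, h⟩ := hU v hv.1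
    obtain ⟨δ, hδ, h'⟩ := hV v hv.2
    refine ⟨min ε δ, lt_min hε hδ, fun w hw => ?_⟩
    have hw' : d v w < min ε δ := hw
    have h1 : d v w < ε := hw'.trans_le (min_le_left _ _)
    have h2 : d v w < δ := hw'.trans_le (min_le_right _ _)
    exact ⟨h h1, h' h2⟩
  isOpen_sUnion := fun S hS v hv => by
    obtain ⟨U, hU, hvU⟩ := hv
    obtain ⟨ε, hε, h⟩ := hS U hU v hvU
    exact ⟨ε, hε, h.trans (subset_sUnion_of_mem hU)⟩

/-- `(M, τ, ·, |·|)` is an `L⁰(μ)`-normed `L⁰(μ)`-module: besides the algebraic axioms, which are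
in the instance arguments, `M` is a topological vector space whose topology is induced by the
distance `moduleDist`, and this distance is complete. -/
class IsL0Module (μ : OuterMeasure X) (A : ℕ → Set X) (M : Type*) [AddCommGroup M] [Module ℝ M]
    [Module (L0 μ) M] [IsScalarTower ℝ (L0 μ) M] [PointwiseNorm μ M] [TopologicalSpace M] :
    Prop where
  isTopologicalAddGroup : IsTopologicalAddGroup M
  continuousSMul : ContinuousSMul ℝ M
  hasBasis : ∀ v : M, (𝓝 v).HasBasis (fun ε : ℝ≥0∞ => 0 < ε) fun ε => {w | moduleDist μ A v w < ε}
  complete : ∀ u : ℕ → M,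
    (∀ ε : ℝ≥0∞, 0 < ε → ∃ N, ∀ p ≥ N, ∀ q ≥ N, moduleDist μ A (u p) (u q) < ε) →
      ∃ v, Tendsto (fun n => moduleDist μ A (u n) v) atTop (𝓝 0)

end Modules

section Quotient

variable {X : Type*} [MetricSpace X] [MeasurableSpace X] [BorelSpace X]

/-- `(Aₖ)` is an increasing sequence of open sets of finite capacity such that every bounded set
is contained in some `Aₖ`. -/
structure IsExhaustion (m : Measure X) (A : ℕ → Set X) : Prop where
  mono : Monotone A
  isOpen : ∀ k, IsOpen (A k)
  cap_lt_top : ∀ k, cap m (A k) < ∞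
  exists_subset : ∀ B : Set X, Bornology.IsBounded B → ∃ k, B ⊆ A k

variable (m : Measure X) (M : Type*) [AddCommGroup M] [Module (L0 (cap m)) M]
  [PointwiseNorm (cap m) M]

/-- The elements `v` with `|v| = 0` `m`-a.e. -/
def nullSubmodule : Submodule (L0 (cap m)) M where
  carrier := {v | Pr m (pnorm (cap m) v) = 0}
  zero_mem' := by
    have : pnorm (cap m) (0 : M) = 0 := (PointwiseNorm.pnorm_eq_zero_iff _).2 rfl
    simp [this]
  add_mem' := by
    intro v w hv hw
    have hv' : Pr m (pnorm (cap m) v) = 0 := hv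
    have hw' : Pr m (pnorm (cap m) w) = 0 := hw
    refine le_antisymm ?_ ?_
    · have := L0.proj_mono (ae_le_ae_cap m)
        (PointwiseNorm.pnorm_add_le (μ := cap m) v w)
      refine this.trans_eq ?_
      change Pr m (pnorm (cap m) v + pnorm (cap m) w) = 0
      rw [map_add, hv', hw', add_zero]
    · have := L0.proj_mono (ae_le_ae_cap m)
        (PointwiseNorm.pnorm_nonneg (μ := cap m) (v + w))
      rwa [map_zero] at this
  smul_mem' := by
    intro f v hv
    have hv' : Pr m (pnorm (cap m) v) = 0 := hv
    have : pnorm (cap m) (f • v) = f.abs * pnorm (cap m) v := PointwiseNorm.pnorm_smul f v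
    simp [this, hv']

/-- `M_m`: the quotient of `M` by the relation `v ∼ w ↔ |v - w| = 0` `m`-a.e. -/
def MQuot : Type _ := M ⧸ nullSubmodule m M

namespace MQuot

instance : AddCommGroup (MQuot m M) := inferInstanceAs (AddCommGroup (M ⧸ nullSubmodule m M))

instance instModuleCap : Module (L0 (cap m)) (MQuot m M) :=
  inferInstanceAs (Module (L0 (cap m)) (M ⧸ nullSubmodule m M))

variable {M}

/-- The class `[v]_m`. -/
def mk (v : M) : MQuot m M := (nullSubmodule m M).mkQ v

theorem mk_surjective : Function.Surjective (mk m : M → MQuot m M) :=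
  (nullSubmodule m M).mkQ_surjective

theorem mk_eq_mk_iff (v w : M) : mk m v = mk m w ↔ Pr m (pnorm (cap m) (v - w)) = 0 :=
  Submodule.Quotient.eq _

theorem cap_smul_mk (f : L0 (cap m)) (v : M) : f • mk m v = mk m (f • v) := rfl

theorem mk_add (v w : M) : mk m (v + w) = mk m v + mk m w := rfl

theorem cap_smul_congr {f g : L0 (cap m)} (h : Pr m f = Pr m g) (x : MQuot m M) :
    f • x = g • x := by
  obtain ⟨v, rfl⟩ := mk_surjective m x
  rw [cap_smul_mk, cap_smul_mk, mk_eq_mk_iff, ← sub_smul]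
  have h1 : pnorm (cap m) ((f - g) • v) = (f - g).abs * pnorm (cap m) v :=
    PointwiseNorm.pnorm_smul (f - g) v
  have h2 : Pr m (f - g).abs = (Pr m (f - g)).abs := L0.proj_abs _ _
  rw [h1, map_mul, h2, map_sub, h, sub_self, L0.abs_zero, zero_mul]

variable (M)

/-- `[f]_m • x = [f]_Cap • x`. -/
instance : SMul (L0 m.toOuterMeasure) (MQuot m M) where
  smul F x := L0.mk (cap m) F.rep F.measurable_rep • x

variable {M}

theorem Pr_smul (f : L0 (cap m)) (x : MQuot m M) : Pr m f • x = f • x :=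
  cap_smul_congr m ((L0.proj_mk _ _ _).trans (L0.mk_rep _)) x

variable (M)

instance : Module (L0 m.toOuterMeasure) (MQuot m M) :=
  Function.Surjective.moduleLeft (Pr m) (L0.proj_surjective _) (Pr_smul m)

variable {M}

theorem smul_mk (f : X → ℝ) (hf : Measurable f) (v : M) :
    L0.mk m.toOuterMeasure f hf • mk m v = mk m (L0.mk (cap m) f hf • v) :=
  Pr_smul m (L0.mk (cap m) f hf) (mk m v)

theorem Pr_pnorm_congr {v w : M} (h : mk m v = mk m w) :
    Pr m (pnorm (cap m) v) = Pr m (pnorm (cap m) w) := by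
  have key : ∀ a b : M, mk m a = mk m b → Pr m (pnorm (cap m) a) ≤ Pr m (pnorm (cap m) b) := by
    intro a b hab
    rw [mk_eq_mk_iff] at hab
    have h1 : pnorm (cap m) (b + (a - b)) ≤ pnorm (cap m) b + pnorm (cap m) (a - b) :=
      PointwiseNorm.pnorm_add_le b (a - b)
    have h2 := L0.proj_mono (ae_le_ae_cap m) h1
    rw [add_sub_cancel] at h2
    change Pr m (pnorm (cap m) a) ≤ Pr m (pnorm (cap m) b + pnorm (cap m) (a - b)) at h2
    rwa [map_add, hab, add_zero] at h2
  exact le_antisymm (key v w h) (key w v h.symm)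

variable (M)

/-- The pointwise norm of `M_m`, `|[v]_m| = Pr |v|`. -/
instance instPointwiseNorm : PointwiseNorm m.toOuterMeasure (MQuot m M) where
  pnorm x := Pr m (pnorm (cap m) (mk_surjective m x).choose)
  pnorm_nonneg x := by
    have := L0.proj_mono (ae_le_ae_cap m)
      (PointwiseNorm.pnorm_nonneg (μ := cap m) (mk_surjective m x).choose)
    rwa [map_zero] at this
  pnorm_eq_zero_iff x := by
    conv_rhs => rw [← (mk_surjective m x).choose_spec]
    have := mk_eq_mk_iff m (mk_surjective m x).choose 0
    rw [sub_zero] at this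
    exact this.symm
  pnorm_add_le x y := by
    obtain ⟨v, rfl⟩ := mk_surjective m x
    obtain ⟨w, rfl⟩ := mk_surjective m y
    rw [Pr_pnorm_congr m (mk_surjective m (mk m v)).choose_spec,
      Pr_pnorm_congr m (mk_surjective m (mk m w)).choose_spec,
      Pr_pnorm_congr m (w := v + w) ((mk_surjective m (mk m v + mk m w)).choose_spec.trans
        (mk_add m v w).symm), ← map_add]
    exact L0.proj_mono (ae_le_ae_cap m) (PointwiseNorm.pnorm_add_le v w)
  pnorm_smul F x := by
    obtain ⟨v, rfl⟩ := mk_surjective m x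
    obtain ⟨f, hf, rfl⟩ := F.exists_mk
    rw [Pr_pnorm_congr m (mk_surjective m (mk m v)).choose_spec,
      Pr_pnorm_congr m ((mk_surjective m _).choose_spec.trans (smul_mk m f hf v))]
    have : pnorm (cap m) (L0.mk (cap m) f hf • v) = (L0.mk (cap m) f hf).abs * pnorm (cap m) v :=
      PointwiseNorm.pnorm_smul _ v
    rw [this, map_mul]
    rfl

variable {M}

theorem pnorm_mk (v : M) : pnorm m.toOuterMeasure (mk m v) = Pr m (pnorm (cap m) v) :=
  Pr_pnorm_congr m (mk_surjective m (mk m v)).choose_spec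

variable (M)
variable [Module ℝ M] [IsScalarTower ℝ (L0 (cap m)) M]

instance : Module ℝ (MQuot m M) := inferInstanceAs (Module ℝ (M ⧸ nullSubmodule m M))

instance : IsScalarTower ℝ (L0 m.toOuterMeasure) (MQuot m M) where
  smul_assoc c F x := by
    obtain ⟨v, rfl⟩ := mk_surjective m x
    obtain ⟨f, hf, rfl⟩ := F.exists_mk
    have h1 : c • L0.mk m.toOuterMeasure f hf =
        L0.mk m.toOuterMeasure (fun x => c * f x) (hf.const_mul c) := rfl
    have h2 : c • L0.mk (cap m) f hf = L0.mk (cap m) (fun x => c * f x) (hf.const_mul c) := rfl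
    rw [h1, smul_mk, smul_mk, ← h2, smul_assoc]
    rfl

end MQuot

/-- `Pr_M : M → M_m`, `v ↦ [v]_m`. -/
def prM [Module ℝ M] [IsScalarTower ℝ (L0 (cap m)) M] : M →ₗ[ℝ] MQuot m M where
  toFun := MQuot.mk m
  map_add' _ _ := rfl
  map_smul' _ _ := rfl

end Quotient

section Universal

/-- The universal property of a couple `(P, π)`, where `P` is an `L⁰(m)`-module and `π : M → P`:
every linear map `T` from `M` to an `L⁰(m)`-module `N` with `|T v| ≤ Pr |v|` factors uniquely
through `π` by a continuous `L⁰(m)`-linear map `P → N`. -/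
def HasUniversalProperty.{w, uX, uM, uP}
    {X : Type uX} [MetricSpace X] [MeasurableSpace X] [BorelSpace X]
    (m : Measure X) (A : ℕ → Set X)
    {M : Type uM} [AddCommGroup M] [Module (L0 (cap m)) M] [PointwiseNorm (cap m) M] [Module ℝ M]
    {P : Type uP} [AddCommGroup P] [Module (L0 m.toOuterMeasure) P] [Module ℝ P]
    [TopologicalSpace P] (π : M →ₗ[ℝ] P) : Prop :=
  ∀ (N : Type w) [AddCommGroup N] [Module ℝ N] [Module (L0 m.toOuterMeasure) N]
    [IsScalarTower ℝ (L0 m.toOuterMeasure) N] [PointwiseNorm m.toOuterMeasure N]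
    [TopologicalSpace N] [IsL0Module m.toOuterMeasure A N] (T : M →ₗ[ℝ] N),
    (∀ v, pnorm m.toOuterMeasure (T v) ≤ Pr m (pnorm (cap m) v)) →
      ∃! S : P →L[L0 m.toOuterMeasure] N, ∀ v, S (π v) = T v

/-- The universal property together with the bound `|S x| ≤ |x|` for the factorising maps `S`. -/
def HasNormedUniversalProperty.{w, uX, uM, uP}
    {X : Type uX} [MetricSpace X] [MeasurableSpace X] [BorelSpace X]
    (m : Measure X) (A : ℕ → Set X)
    {M : Type uM} [AddCommGroup M] [Module (L0 (cap m)) M] [PointwiseNorm (cap m) M] [Module ℝ M]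
    {P : Type uP} [AddCommGroup P] [Module (L0 m.toOuterMeasure) P] [Module ℝ P]
    [PointwiseNorm m.toOuterMeasure P] [TopologicalSpace P] (π : M →ₗ[ℝ] P) : Prop :=
  HasUniversalProperty.{w, uX, uM, uP} m A π ∧
  ∀ (N : Type w) [AddCommGroup N] [Module ℝ N] [Module (L0 m.toOuterMeasure) N]
    [IsScalarTower ℝ (L0 m.toOuterMeasure) N] [PointwiseNorm m.toOuterMeasure N]
    [TopologicalSpace N] [IsL0Module m.toOuterMeasure A N] (T : M →ₗ[ℝ] N),
    (∀ v, pnorm m.toOuterMeasure (T v) ≤ Pr m (pnorm (cap m) v)) →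
      ∀ S : P →L[L0 m.toOuterMeasure] N, (∀ v, S (π v) = T v) →
        ∀ x, pnorm m.toOuterMeasure (S x) ≤ pnorm m.toOuterMeasure x

end Universal
end CapModule
end

universe w uX u
open CapModule

/-!
The quotient `M_m` is treated through the finite measure `∑ₖ 2⁻ᵏ (m(Aₖ) ∨ 1)⁻¹ m|_{Aₖ}`, against
which the distance of an `L⁰(m)`-module is the integral of `|v - w| ∧ 1`
(`moduleDist_eq_lintegral`). All topological vector space properties of `M_m` follow from this
(`isL0Module_topologyOfDist`), and the only substantial point is completeness.

Integration with respect to the capacity is not additive and has no dominated convergence theorem,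
so a Cauchy sequence `[vₙ]` of `M_m` cannot be made Cauchy in `M` by discarding sets of small
measure. Instead, after passing to a rapidly converging subsequence, everything is multiplied by the
bounded function `f = (1 + supₙ 2ⁿ |vₙ₊₁ - vₙ|)⁻¹`, which is `m`-a.e. positive
on `⋃ₖ Aₖ` (`exists_rescaling`). Then `|f vₙ₊₁ - f vₙ| ≤ 2⁻ⁿ` outside a set of zero capacity, so
that `f vₙ` is Cauchy in `M` and has a limit `w` (`exists_limit_of_geometric`). The limit of `[vₙ]`
is `f⁻¹ [w]`: division by `f`, meaningless in `M` where `f` vanishes, is harmless `m`-a.e.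
(`exists_limit_of_tsum_ne_top`).

For the universal property, a linear map `T` with `|T v| ≤ Pr |v|` factors through `M_m` as a map of
sets, and the factorisation does not increase the pointwise norm, hence is continuous. It is
`L⁰(m)`-linear because `|T (f v) - f T v| ≤ 2 |f - q| |v|` for every rational `q`, with one common
null set for all `q` (`map_smul_of_pnorm_le`). Uniqueness of the couple is the usual argument
comparing two universal objects (`exists_equiv_of_hasUniversalProperty`).
-/

noncomputable section

namespace CapModule

/-! ### Borel representatives and the pointwise norm -/

namespace L0

variable {X : Type*} [MeasurableSpace X] {μ ν : OuterMeasure X}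

theorem rep_mk (f : X → ℝ) (hf : Measurable f) : (mk μ f hf).rep =ᵐ[μ] f :=
  mk_eq_mk.1 (mk_rep _)

theorem le_iff_rep {F G : L0 μ} : F ≤ G ↔ F.rep ≤ᵐ[μ] G.rep := by
  conv_lhs => rw [← mk_rep F, ← mk_rep G]
  exact mk_le_mk

theorem rep_add (F G : L0 μ) : (F + G).rep =ᵐ[μ] fun x => F.rep x + G.rep x := by
  conv_lhs => rw [← mk_rep F, ← mk_rep G]
  exact rep_mk (fun x => F.rep x + G.rep x) (F.measurable_rep.add G.measurable_rep)

theorem rep_sub (F G : L0 μ) : (F - G).rep =ᵐ[μ] fun x => F.rep x - G.rep x := by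
  filter_upwards [rep_add (F - G) G] with x hx
  rw [sub_add_cancel] at hx
  rw [hx, add_sub_cancel_right]

theorem rep_mul (F G : L0 μ) : (F * G).rep =ᵐ[μ] fun x => F.rep x * G.rep x := by
  conv_lhs => rw [← mk_rep F, ← mk_rep G]
  exact rep_mk (fun x => F.rep x * G.rep x) (F.measurable_rep.mul G.measurable_rep)

theorem rep_abs (F : L0 μ) : F.abs.rep =ᵐ[μ] fun x => |F.rep x| := by
  conv_lhs => rw [← mk_rep F, abs_mk]
  exact rep_mk _ _

theorem rep_zero : (0 : L0 μ).rep =ᵐ[μ] fun _ => 0 := rep_mk (fun _ => 0) measurable_const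

theorem rep_one : (1 : L0 μ).rep =ᵐ[μ] fun _ => 1 := rep_mk (fun _ => 1) measurable_const

theorem rep_algebraMap (c : ℝ) : (algebraMap ℝ (L0 μ) c).rep =ᵐ[μ] fun _ => c :=
  rep_mk (fun _ => c) measurable_const

theorem rep_proj (h : ae ν ≤ ae μ) (F : L0 μ) : (proj h F).rep =ᵐ[ν] F.rep := by
  conv_lhs => rw [← mk_rep F, proj_mk]
  exact rep_mk _ _

end L0

section PointwiseNorm

variable {X : Type*} [MeasurableSpace X] {μ : OuterMeasure X} {M : Type*} [AddCommGroup M]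
  [Module (L0 μ) M] [PointwiseNorm μ M]

theorem pnorm_zero : pnorm μ (0 : M) = 0 := (PointwiseNorm.pnorm_eq_zero_iff _).2 rfl

theorem pnorm_smul (f : L0 μ) (v : M) : pnorm μ (f • v) = f.abs * pnorm μ v :=
  PointwiseNorm.pnorm_smul f v

theorem pnorm_neg (v : M) : pnorm μ (-v) = pnorm μ v := by
  have h : (-1 : L0 μ).abs = 1 := by
    change L0.mk μ (fun _ => |(-1 : ℝ)|) measurable_const
      = L0.mk μ (fun _ => (1 : ℝ)) measurable_const
    simp
  rw [← neg_one_smul (L0 μ) v, pnorm_smul, h, one_mul]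

theorem pnorm_sub_comm (v w : M) : pnorm μ (v - w) = pnorm μ (w - v) := by
  rw [← pnorm_neg, neg_sub]

theorem rep_pnorm_nonneg (v : M) : ∀ᵐ x ∂μ, 0 ≤ (pnorm μ v).rep x := by
  filter_upwards [L0.le_iff_rep.1 (PointwiseNorm.pnorm_nonneg (μ := μ) v), L0.rep_zero (μ := μ)]
    with x hx h0
  exact h0.symm.trans_le hx

theorem rep_pnorm_add_le (v w : M) :
    ∀ᵐ x ∂μ, (pnorm μ (v + w)).rep x ≤ (pnorm μ v).rep x + (pnorm μ w).rep x := by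
  filter_upwards [L0.le_iff_rep.1 (PointwiseNorm.pnorm_add_le (μ := μ) v w),
    L0.rep_add (pnorm μ v) (pnorm μ w)] with x hx h
  exact hx.trans_eq h

theorem rep_pnorm_smul (f : L0 μ) (v : M) :
    ∀ᵐ x ∂μ, (pnorm μ (f • v)).rep x = |f.rep x| * (pnorm μ v).rep x := by
  rw [pnorm_smul]
  filter_upwards [L0.rep_mul f.abs (pnorm μ v), L0.rep_abs f] with x h h'
  rw [h, h']

theorem pnorm_eq_zero_of_rep_le {v : M} (h : ∀ᵐ x ∂μ, (pnorm μ v).rep x ≤ 0) : v = 0 := by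
  refine (PointwiseNorm.pnorm_eq_zero_iff (μ := μ) v).1 (le_antisymm (L0.le_iff_rep.2 ?_)
    (PointwiseNorm.pnorm_nonneg v))
  filter_upwards [h, L0.rep_zero (μ := μ)] with x hx h0
  exact hx.trans_eq h0.symm

/-- A uniform bound on consecutive differences that decays geometrically telescopes. -/
theorem rep_pnorm_sub_le_of_geometric {w : ℕ → M}
    (hw : ∀ n, ∀ᵐ x ∂μ, (pnorm μ (w (n + 1) - w n)).rep x ≤ (1 / 2) ^ n) (n i : ℕ) :
    ∀ᵐ x ∂μ, (pnorm μ (w (n + i) - w n)).rep x ≤ 2 * (1 / 2) ^ n * (1 - (1 / 2) ^ i) := by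
  induction i with
  | zero =>
    simp only [add_zero, sub_self, pow_zero, mul_zero, pnorm_zero]
    filter_upwards [L0.rep_zero (μ := μ)] with x hx
    exact hx.le
  | succ i ih =>
    have h := rep_pnorm_add_le (μ := μ) (w (n + i + 1) - w (n + i)) (w (n + i) - w n)
    rw [sub_add_sub_cancel] at h
    filter_upwards [h, hw (n + i), ih] with x h1 h2 h3
    refine h1.trans ((add_le_add h2 h3).trans (le_of_eq ?_))
    ring

end PointwiseNorm

/-! ### The distance of an `L⁰(m)`-module as an integral against a finite measure -/

section Weighted

variable {X : Type*} [MeasurableSpace X]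

/-- The measure `∑ₖ 2⁻ᵏ (m(Aₖ) ∨ 1)⁻¹ m|_{Aₖ}`, against which `moduleDist` is the integral of
`|v - w| ∧ 1`. -/
def weightedMeasure (m : Measure X) (A : ℕ → Set X) : Measure X :=
  Measure.sum fun k => (2 ^ k * max (m (A k)) 1)⁻¹ • m.restrict (A k)

variable {m : Measure X} {A : ℕ → Set X}

theorem div_weight_le (k : ℕ) (a : ℝ≥0∞) : a / (2 ^ k * max a 1) ≤ (2 ^ k)⁻¹ := by
  rw [div_eq_mul_inv, ENNReal.mul_inv (Or.inl (by positivity)) (Or.inl (by finiteness)),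
    mul_left_comm]
  refine mul_le_of_le_one_right' ?_
  rw [← div_eq_mul_inv]
  exact ENNReal.div_le_of_le_mul (by rw [one_mul]; exact le_max_left _ _)

theorem tsum_two_pow_inv : ∑' k : ℕ, ((2 : ℝ≥0∞) ^ k)⁻¹ = 2 := by
  simp_rw [ENNReal.inv_pow, ENNReal.tsum_geometric, ENNReal.one_sub_inv_two, inv_inv]

instance isFiniteMeasure_weightedMeasure : IsFiniteMeasure (weightedMeasure m A) where
  measure_univ_lt_top := by
    rw [weightedMeasure, Measure.sum_apply _ MeasurableSet.univ]
    refine (ENNReal.tsum_le_tsum (g := fun k => ((2 : ℝ≥0∞) ^ k)⁻¹) fun k => ?_).trans_lt ?_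
    · rw [Measure.smul_apply, Measure.restrict_apply_univ, smul_eq_mul, mul_comm, ← div_eq_mul_inv]
      exact div_weight_le k _
    · rw [tsum_two_pow_inv]
      exact ENNReal.ofNat_lt_top

theorem ae_weightedMeasure_of_forall_restrict {p : X → Prop}
    (h : ∀ k, ∀ᵐ x ∂m.restrict (A k), p x) : ∀ᵐ x ∂weightedMeasure m A, p x := by
  rw [weightedMeasure]
  exact Measure.ae_sum_iff.2 fun k => Measure.ae_smul_measure (h k) _

theorem ae_weightedMeasure {p : X → Prop} (h : ∀ᵐ x ∂m.toOuterMeasure, p x) :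
    ∀ᵐ x ∂weightedMeasure m A, p x := by
  have h' : ∀ᵐ x ∂m, p x := h
  exact ae_weightedMeasure_of_forall_restrict fun k => ae_restrict_of_ae h'

theorem outerSetIntegral_toOuterMeasure {E : Set X} (hE : MeasurableSet E) {g : X → ℝ}
    (hg : Measurable g) :
    outerSetIntegral m.toOuterMeasure E (fun x => ENNReal.ofReal (g x))
      = ∫⁻ x in E, ENNReal.ofReal (g x) ∂m := by
  have h : E.indicator (fun x => ENNReal.ofReal (g x))
      = fun x => ENNReal.ofReal (E.indicator (fun x => max (g x) 0) x) := by
    ext x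
    by_cases hx : x ∈ E <;> simp [hx, ENNReal.ofReal_max]
  rw [outerSetIntegral, ← lintegral_indicator hE, h]
  exact outerIntegral_toOuterMeasure m ((hg.max measurable_const).indicator hE)
    (indicator_nonneg fun x _ => le_max_right _ _)

variable {M : Type*} [AddCommGroup M] [Module (L0 m.toOuterMeasure) M]
  [PointwiseNorm m.toOuterMeasure M]

theorem moduleDist_eq_lintegral (hA : ∀ k, MeasurableSet (A k)) (v w : M) :
    moduleDist m.toOuterMeasure A v w = ∫⁻ x, ENNReal.ofReal
      (min ((pnorm m.toOuterMeasure (v - w)).rep x) 1) ∂weightedMeasure m A := by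
  rw [weightedMeasure, lintegral_sum_measure]
  refine tsum_congr fun k => ?_
  rw [lintegral_smul_measure, smul_eq_mul, outerSetIntegral_toOuterMeasure (hA k)
    ((L0.measurable_rep _).min measurable_const), div_eq_mul_inv, mul_comm]
  rfl

theorem lintegral_min_mono {v : M} {g : X → ℝ}
    (h : ∀ᵐ x ∂weightedMeasure m A, (pnorm m.toOuterMeasure v).rep x ≤ g x) :
    ∫⁻ x, ENNReal.ofReal (min ((pnorm m.toOuterMeasure v).rep x) 1) ∂weightedMeasure m A
      ≤ ∫⁻ x, ENNReal.ofReal (min (g x) 1) ∂weightedMeasure m A := by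
  refine lintegral_mono_ae ?_
  filter_upwards [h] with x hx
  gcongr

theorem moduleDist_self (hA : ∀ k, MeasurableSet (A k)) (v : M) :
    moduleDist m.toOuterMeasure A v v = 0 := by
  rw [moduleDist_eq_lintegral hA, sub_self, pnorm_zero]
  refine lintegral_eq_zero_of_ae_eq_zero ?_
  filter_upwards [ae_weightedMeasure (L0.rep_zero (μ := m.toOuterMeasure))] with x hx
  simp [hx]

theorem moduleDist_comm {μ : OuterMeasure X} {M : Type*} [AddCommGroup M] [Module (L0 μ) M]
    [PointwiseNorm μ M] (v w : M) : moduleDist μ A v w = moduleDist μ A w v := by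
  simp only [moduleDist, pnorm_sub_comm v w]

theorem moduleDist_add_right {μ : OuterMeasure X} {M : Type*} [AddCommGroup M] [Module (L0 μ) M]
    [PointwiseNorm μ M] (u v w : M) : moduleDist μ A (v + u) (w + u) = moduleDist μ A v w := by
  simp only [moduleDist, add_sub_add_right_eq_sub]

theorem moduleDist_triangle (hA : ∀ k, MeasurableSet (A k)) (u v w : M) :
    moduleDist m.toOuterMeasure A u w
      ≤ moduleDist m.toOuterMeasure A u v + moduleDist m.toOuterMeasure A v w := by
  simp only [moduleDist_eq_lintegral hA]
  rw [← lintegral_add_left ((L0.measurable_rep _).min measurable_const).ennreal_ofReal]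
  refine lintegral_mono_ae ?_
  have h := rep_pnorm_add_le (μ := m.toOuterMeasure) (u - v) (v - w)
  rw [sub_add_sub_cancel] at h
  filter_upwards [ae_weightedMeasure h,
    ae_weightedMeasure (rep_pnorm_nonneg (μ := m.toOuterMeasure) (u - v)),
    ae_weightedMeasure (rep_pnorm_nonneg (μ := m.toOuterMeasure) (v - w))] with x h1 h2 h3
  rw [← ENNReal.ofReal_add (le_min h2 zero_le_one) (le_min h3 zero_le_one)]
  refine ENNReal.ofReal_le_ofReal ?_
  rcases min_cases ((pnorm m.toOuterMeasure (u - v)).rep x) 1 with h4 | h4 <;>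
  rcases min_cases ((pnorm m.toOuterMeasure (v - w)).rep x) 1 with h5 | h5 <;>
  rcases min_cases ((pnorm m.toOuterMeasure (u - w)).rep x) 1 with h6 | h6 <;>
  linarith

theorem moduleDist_add_add_le (hA : ∀ k, MeasurableSet (A k)) (v w v' w' : M) :
    moduleDist m.toOuterMeasure A (v + w) (v' + w')
      ≤ moduleDist m.toOuterMeasure A v v' + moduleDist m.toOuterMeasure A w w' := by
  refine (moduleDist_triangle hA _ (v' + w) _).trans (add_le_add ?_ ?_)
  · rw [moduleDist_add_right]
  · rw [add_comm v' w, add_comm v' w', moduleDist_add_right]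

/-- Pointwise a.e. convergence to zero of the norm forces convergence in distance. -/
theorem tendsto_moduleDist_of_rep_le (hA : ∀ k, MeasurableSet (A k)) {ι : Type*} {l : Filter ι}
    [l.IsCountablyGenerated] {v w : ι → M} {g : ι → X → ℝ}
    (hle : ∀ i, ∀ᵐ x ∂weightedMeasure m A,
      (pnorm m.toOuterMeasure (v i - w i)).rep x ≤ g i x)
    (hg : ∀ i, Measurable (g i))
    (h0 : ∀ᵐ x ∂weightedMeasure m A, Tendsto (fun i => g i x) l (𝓝 0)) :
    Tendsto (fun i => moduleDist m.toOuterMeasure A (v i) (w i)) l (𝓝 0) := by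
  have key : Tendsto (fun i => ∫⁻ x, ENNReal.ofReal (min (g i x) 1) ∂weightedMeasure m A) l
      (𝓝 (∫⁻ _, 0 ∂weightedMeasure m A)) := by
    refine tendsto_lintegral_filter_of_dominated_convergence (fun _ => 1)
      (Eventually.of_forall fun i => ((hg i).min measurable_const).ennreal_ofReal)
      (Eventually.of_forall fun i => Eventually.of_forall fun x => ?_) (by simp) ?_
    · simp
    · filter_upwards [h0] with x hx
      have := ENNReal.tendsto_ofReal (hx.min (tendsto_const_nhds (x := (1 : ℝ))))
      simpa using this
  rw [lintegral_zero] at key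
  refine tendsto_of_tendsto_of_tendsto_of_le_of_le tendsto_const_nhds key (fun _ => zero_le)
    fun i => ?_
  simp only [moduleDist_eq_lintegral hA]
  exact lintegral_min_mono (hle i)

/-- A map that does not increase the pointwise norm does not increase the distance. -/
theorem moduleDist_map_le {N : Type*} [AddCommGroup N] [Module (L0 m.toOuterMeasure) N]
    [PointwiseNorm m.toOuterMeasure N] (hA : ∀ k, MeasurableSet (A k))
    {F : Type*} [FunLike F M N] [AddMonoidHomClass F M N] (S : F)
    (hS : ∀ x, pnorm m.toOuterMeasure (S x) ≤ pnorm m.toOuterMeasure x) (v w : M) :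
    moduleDist m.toOuterMeasure A (S v) (S w) ≤ moduleDist m.toOuterMeasure A v w := by
  rw [moduleDist_eq_lintegral hA, moduleDist_eq_lintegral hA, ← map_sub]
  exact lintegral_min_mono (ae_weightedMeasure (L0.le_iff_rep.1 (hS _)))

theorem hasBasis_nhds_topologyOfDist {α : Type*} {d : α → α → ℝ≥0∞} (h0 : ∀ a, d a a = 0)
    (htri : ∀ a b c, d a c ≤ d a b + d b c) (a : α) :
    (@nhds α (topologyOfDist d) a).HasBasis (fun ε : ℝ≥0∞ => 0 < ε) fun ε => {b | d a b < ε} := by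
  let := topologyOfDist d
  refine ⟨fun s => ⟨fun hs => ?_, ?_⟩⟩
  · obtain ⟨U, hUs, hU, haU⟩ := mem_nhds_iff.1 hs
    obtain ⟨ε, hε, h⟩ := hU a haU
    exact ⟨ε, hε, h.trans hUs⟩
  · rintro ⟨ε, hε, h⟩
    refine mem_of_superset (IsOpen.mem_nhds (fun b hb => ?_) ?_) h
    · refine ⟨ε - d a b, tsub_pos_of_lt hb, fun c hc => ?_⟩
      exact (htri a b c).trans_lt (lt_tsub_iff_left.1 hc)
    · change d a a < ε
      rwa [h0]

end Weighted

/-! ### Uniform convergence with respect to an outer measure -/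

section Outer

variable {X : Type*}

theorem outerIntegral_mono_measure {μ ν : OuterMeasure X} (h : ∀ s, ν s ≤ μ s) (f : X → ℝ≥0∞) :
    outerIntegral ν f ≤ outerIntegral μ f :=
  lintegral_mono fun _ => h _

theorem outerSetIntegral_le_of_ae_le {μ : OuterMeasure X} {E : Set X} {g : X → ℝ} {ε : ℝ}
    (hg : ∀ᵐ x ∂μ, g x ≤ ε) :
    outerSetIntegral μ E (fun x => ENNReal.ofReal (g x)) ≤ ENNReal.ofReal ε * μ E := by
  calc outerSetIntegral μ E (fun x => ENNReal.ofReal (g x))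
      ≤ ∫⁻ t in Ioi (0 : ℝ), (Iio ε).indicator (fun _ => μ E) t := by
        refine setLIntegral_mono (measurable_const.indicator measurableSet_Iio) fun t ht => ?_
        by_cases htε : t < ε
        · rw [indicator_of_mem (mem_Iio.2 htε)]
          refine measure_mono fun x hx => ?_
          by_contra hxE
          simp [indicator_of_notMem hxE] at hx
        · rw [indicator_of_notMem (by simpa using htε)]
          refine le_of_eq (measure_mono_null (fun x hx => ?_) hg)
          intro (hgx : g x ≤ ε)
          have hx' : ENNReal.ofReal t < E.indicator (fun x => ENNReal.ofReal (g x)) x := hx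
          have h2 : E.indicator (fun x => ENNReal.ofReal (g x)) x ≤ ENNReal.ofReal (g x) :=
            indicator_le_self' (fun _ _ => zero_le) x
          exact absurd (hx'.trans_le h2)
            (not_lt.2 (ENNReal.ofReal_le_ofReal (hgx.trans (not_lt.1 htε))))
    _ = ENNReal.ofReal ε * μ E := by
        rw [lintegral_indicator measurableSet_Iio, Measure.restrict_restrict measurableSet_Iio,
          setLIntegral_const, inter_comm, Ioi_inter_Iio, Real.volume_Ioo, sub_zero, mul_comm]

variable [MeasurableSpace X]

theorem moduleDist_le_of_ae_le {μ : OuterMeasure X} {A : ℕ → Set X} {M : Type*} [AddCommGroup M]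
    [Module (L0 μ) M] [PointwiseNorm μ M] {v w : M} {ε : ℝ}
    (h : ∀ᵐ x ∂μ, (pnorm μ (v - w)).rep x ≤ ε) :
    moduleDist μ A v w ≤ ENNReal.ofReal ε * 2 := by
  rw [← tsum_two_pow_inv, ← ENNReal.tsum_mul_left, moduleDist]
  refine ENNReal.tsum_le_tsum fun k => ?_
  calc _ ≤ ENNReal.ofReal ε * μ (A k) / (2 ^ k * max (μ (A k)) 1) := by
        refine ENNReal.div_le_div_right (outerSetIntegral_le_of_ae_le ?_) _
        filter_upwards [h] with x hx
        exact (min_le_left _ _).trans hx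
    _ ≤ _ := by
        rw [mul_div_assoc]
        gcongr
        exact div_weight_le k _

end Outer

section CapConvergence

variable {X : Type*} [MetricSpace X] [MeasurableSpace X] [BorelSpace X] {m : Measure X}
  {A : ℕ → Set X} {M : Type*} [AddCommGroup M] [Module (L0 (cap m)) M] [PointwiseNorm (cap m) M]

theorem ae_of_ae_cap {p : X → Prop} (h : ∀ᵐ x ∂cap m, p x) : ∀ᵐ x ∂weightedMeasure m A, p x :=
  ae_weightedMeasure (ae_le_ae_cap m h)

/-- By Fatou's lemma, convergence in the capacitary distance makes the pointwise norms of the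
differences arbitrarily small infinitely often, at almost every point. -/
theorem ae_liminf_eq_zero_of_tendsto_moduleDist (hA : IsExhaustion m A) {w : ℕ → M} {v : M}
    (h : Tendsto (fun n => moduleDist (cap m) A (w n) v) atTop (𝓝 0)) :
    ∀ᵐ x ∂weightedMeasure m A, liminf
      (fun n => ENNReal.ofReal (min ((pnorm (cap m) (w n - v)).rep x) 1)) atTop = 0 := by
  refine ae_weightedMeasure_of_forall_restrict fun k => ?_
  have hmeas : ∀ n, Measurable fun x =>
      ENNReal.ofReal (min ((pnorm (cap m) (w n - v)).rep x) 1) := fun n =>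
    ((L0.measurable_rep _).min measurable_const).ennreal_ofReal
  set c : ℝ≥0∞ := 2 ^ k * max (cap m (A k)) 1 with hc
  have hc0 : c ≠ 0 := by positivity
  have hct : c ≠ ∞ := ENNReal.mul_ne_top (by finiteness)
    (max_lt (hA.cap_lt_top k) ENNReal.one_lt_top).ne
  have hle : ∀ n, ∫⁻ x in A k, ENNReal.ofReal (min ((pnorm (cap m) (w n - v)).rep x) 1) ∂m
      ≤ moduleDist (cap m) A (w n) v * c := fun n => by
    rw [← outerSetIntegral_toOuterMeasure (hA.isOpen k).measurableSet
      ((L0.measurable_rep _).min measurable_const)]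
    refine (outerIntegral_mono_measure (measure_le_cap m) _).trans ?_
    rw [← ENNReal.div_le_iff hc0 hct]
    exact ENNReal.le_tsum (f := fun k => outerSetIntegral (cap m) (A k) (fun x =>
      ENNReal.ofReal (min ((pnorm (cap m) (w n - v)).rep x) 1)) /
        (2 ^ k * max (cap m (A k)) 1)) k
  have hlim : Tendsto (fun n => moduleDist (cap m) A (w n) v * c) atTop (𝓝 0) := by
    simpa using ENNReal.Tendsto.mul_const h (Or.inr hct)
  have h0 := tendsto_of_tendsto_of_tendsto_of_le_of_le tendsto_const_nhds hlim
    (fun _ => zero_le) hle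
  have hfatou := lintegral_liminf_le (u := atTop) (μ := m.restrict (A k)) hmeas
  rw [h0.liminf_eq] at hfatou
  exact (lintegral_eq_zero_iff (Measurable.liminf hmeas)).1 (le_antisymm hfatou zero_le)

/-- A sequence which is uniformly geometrically Cauchy with respect to the capacity has a limit
`w`, and the rate of convergence is preserved almost everywhere. -/
theorem exists_limit_of_geometric [Module ℝ M] [IsScalarTower ℝ (L0 (cap m)) M]
    [TopologicalSpace M] [IsL0Module (cap m) A M] (hA : IsExhaustion m A) {w : ℕ → M}
    (hw : ∀ n, ∀ᵐ x ∂cap m, (pnorm (cap m) (w (n + 1) - w n)).rep x ≤ (1 / 2) ^ n) :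
    ∃ v : M, ∀ n, ∀ᵐ x ∂weightedMeasure m A,
      (pnorm (cap m) (w n - v)).rep x ≤ 2 * (1 / 2) ^ n := by
  have htel : ∀ n i, ∀ᵐ x ∂cap m, (pnorm (cap m) (w (n + i) - w n)).rep x ≤ 2 * (1 / 2) ^ n := by
    intro n i
    filter_upwards [rep_pnorm_sub_le_of_geometric hw n i] with x hx
    refine hx.trans (mul_le_of_le_one_right (by positivity) ?_)
    linarith [show (0 : ℝ) ≤ (1 / 2) ^ i by positivity]
  have hdist : ∀ n, ∀ p ≥ n, ∀ q ≥ p, moduleDist (cap m) A (w q) (w p)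
      ≤ ENNReal.ofReal (2 * (1 / 2) ^ n) * 2 := by
    intro n p hp q hq
    obtain ⟨i, rfl⟩ := Nat.exists_eq_add_of_le hq
    refine moduleDist_le_of_ae_le ?_
    filter_upwards [htel p i] with x hx
    refine hx.trans (mul_le_mul_of_nonneg_left ?_ zero_le_two)
    exact pow_le_pow_of_le_one (by norm_num) (by norm_num) hp
  have hpow : Tendsto (fun n : ℕ => (2 : ℝ) * (1 / 2) ^ n) atTop (𝓝 0) := by
    simpa using (tendsto_pow_atTop_nhds_zero_of_lt_one (r := (1 / 2 : ℝ)) (by norm_num)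
      (by norm_num)).const_mul 2
  have hrate : Tendsto (fun n : ℕ => ENNReal.ofReal (2 * (1 / 2) ^ n) * 2) atTop (𝓝 0) := by
    simpa using ENNReal.Tendsto.mul_const (ENNReal.tendsto_ofReal hpow)
      (Or.inr ENNReal.ofNat_ne_top)
  obtain ⟨v, hv⟩ := IsL0Module.complete (μ := cap m) (A := A) w fun ε hε => by
    obtain ⟨n, hn⟩ := (hrate.eventually_lt_const hε).exists
    refine ⟨n, fun p hp q hq => lt_of_le_of_lt ?_ hn⟩
    rcases le_total p q with h | h
    · rw [moduleDist_comm]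
      exact hdist n p hp q h
    · exact hdist n q hq p h
  refine ⟨v, fun n => ?_⟩
  have htri : ∀ i, ∀ᵐ x ∂weightedMeasure m A, (pnorm (cap m) (w n - v)).rep x
      ≤ 2 * (1 / 2) ^ n + (pnorm (cap m) (w (n + i) - v)).rep x := fun i => by
    have h := rep_pnorm_add_le (μ := cap m) (w n - w (n + i)) (w (n + i) - v)
    rw [sub_add_sub_cancel, pnorm_sub_comm (w n) (w (n + i))] at h
    filter_upwards [ae_of_ae_cap h, ae_of_ae_cap (htel n i)] with x h1 h2
    linarith
  filter_upwards [ae_all_iff.2 htri, ae_liminf_eq_zero_of_tendsto_moduleDist hA hv] with x h1 h2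
  by_contra! hlt
  set δ := (pnorm (cap m) (w n - v)).rep x - 2 * (1 / 2) ^ n with hδ
  have hδ0 : 0 < min δ 1 := lt_min (by linarith) one_pos
  refine (ENNReal.ofReal_pos.2 hδ0).ne' (le_antisymm ?_ zero_le)
  rw [← h2]
  refine le_liminf_of_le (by isBoundedDefault) (eventually_atTop.2 ⟨n, fun j hj => ?_⟩)
  obtain ⟨i, rfl⟩ := Nat.exists_eq_add_of_le hj
  have := h1 i
  gcongr
  linarith

end CapConvergence

/-! ### Completeness of the quotient -/

section Complete

/-- Measurable functions `Δₙ` whose truncations have rapidly decaying integrals are made uniformly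
geometrically small by one bounded factor `f`, positive almost everywhere:
`f = (1 + supₙ 2ⁿ Δₙ)⁻¹`. -/
theorem exists_rescaling {X : Type*} [MeasurableSpace X] {ν : Measure X} {Δ : ℕ → X → ℝ}
    (hΔ : ∀ n, Measurable (Δ n))
    (hsum : ∑' n, 2 ^ n * ∫⁻ x, ENNReal.ofReal (min (Δ n x) 1) ∂ν ≠ ∞) :
    ∃ f : X → ℝ, Measurable f ∧ (∀ x, 0 ≤ f x) ∧ (∀ n x, f x * Δ n x ≤ (1 / 2) ^ n) ∧
      ∀ᵐ x ∂ν, f x ≠ 0 := by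
  set g : X → ℝ≥0∞ := fun x => ⨆ n, 2 ^ n * ENNReal.ofReal (Δ n x) with hg
  have hgm : Measurable g := Measurable.iSup fun n => (hΔ n).ennreal_ofReal.const_mul _
  refine ⟨fun x => ((1 + g x)⁻¹).toReal, (measurable_const.add hgm).inv.ennreal_toReal,
    fun x => ENNReal.toReal_nonneg, fun n x => ?_, ?_⟩
  · rcases eq_or_ne (g x) ∞ with h | h
    · simp [h]
    have h1 : (2 ^ n * ENNReal.ofReal (Δ n x)) ≤ g x :=
      le_iSup (fun n => 2 ^ n * ENNReal.ofReal (Δ n x)) n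
    have h2 := ENNReal.toReal_mono h h1
    rw [ENNReal.toReal_mul, ENNReal.toReal_pow, ENNReal.toReal_ofNat,
      ENNReal.toReal_ofReal'] at h2
    have h3 : (2 : ℝ) ^ n * Δ n x ≤ (g x).toReal :=
      (mul_le_mul_of_nonneg_left (le_max_left _ _) (by positivity)).trans h2
    have h4 : (0 : ℝ) ≤ (g x).toReal := ENNReal.toReal_nonneg
    beta_reduce
    rw [ENNReal.toReal_inv, ENNReal.toReal_add ENNReal.one_ne_top h, ENNReal.toReal_one,
      inv_mul_le_iff₀ (by linarith), one_div, inv_pow, ← div_eq_mul_inv,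
      le_div_iff₀ (by positivity)]
    linarith
  · have hm : ∀ n, Measurable fun x => 2 ^ n * ENNReal.ofReal (min (Δ n x) 1) := fun n =>
      ((hΔ n).min measurable_const).ennreal_ofReal.const_mul _
    have hfin : ∫⁻ x, ∑' n, 2 ^ n * ENNReal.ofReal (min (Δ n x) 1) ∂ν ≠ ∞ := by
      rw [lintegral_tsum fun n => (hm n).aemeasurable]
      simpa only [lintegral_const_mul _ ((hΔ _).min measurable_const).ennreal_ofReal] using hsum
    filter_upwards [ae_lt_top (Measurable.tsum hm) hfin] with x hx
    set C := ∑' n, 2 ^ n * ENNReal.ofReal (min (Δ n x) 1) with hC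
    have hle : ∀ n, 2 ^ n * ENNReal.ofReal (min (Δ n x) 1) ≤ C := fun n => ENNReal.le_tsum n
    obtain ⟨N, hN⟩ : ∃ N : ℕ, C < 2 ^ N := by
      obtain ⟨N, hN⟩ := ENNReal.exists_nat_gt hx.ne
      exact ⟨N, hN.trans (by exact_mod_cast Nat.lt_two_pow_self)⟩
    -- from `N` on the truncation at `1` is not active
    have htail : ∀ n, 2 ^ n * ENNReal.ofReal (Δ n x)
        ≤ C + ∑ j ∈ Finset.range N, 2 ^ j * ENNReal.ofReal (Δ j x) := fun n => by
      rcases lt_or_ge n N with hn | hn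
      · exact le_add_left (Finset.single_le_sum
          (f := fun j => 2 ^ j * ENNReal.ofReal (Δ j x)) (fun _ _ => zero_le)
          (Finset.mem_range.2 hn))
      · refine le_add_right ?_
        have h1 : Δ n x < 1 := by
          by_contra! h
          have h2 := hle n
          rw [min_eq_right h, ENNReal.ofReal_one, mul_one] at h2
          exact absurd (h2.trans_lt hN) (not_lt.2 (pow_le_pow_right₀ (by norm_num) hn))
        simpa [min_eq_left h1.le] using hle n
    have hgx : g x ≠ ∞ := by
      refine ne_top_of_le_ne_top ?_ (iSup_le htail)
      exact ENNReal.add_ne_top.2 ⟨hx.ne, ENNReal.sum_ne_top.2 fun j _ => by finiteness⟩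
    exact ENNReal.toReal_ne_zero.2 ⟨ENNReal.inv_ne_zero.2 (by finiteness), by simp⟩

variable {X : Type*} [MetricSpace X] [MeasurableSpace X] [BorelSpace X] {m : Measure X}
  {A : ℕ → Set X} {M : Type*} [AddCommGroup M] [Module (L0 (cap m)) M] [PointwiseNorm (cap m) M]

theorem rep_pnorm_mk_sub (v w : M) : ∀ᵐ x ∂weightedMeasure m A,
    (pnorm m.toOuterMeasure (MQuot.mk m v - MQuot.mk m w)).rep x
      = (pnorm (cap m) (v - w)).rep x := by
  change ∀ᵐ x ∂weightedMeasure m A, (pnorm m.toOuterMeasure (MQuot.mk m (v - w))).rep x = _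
  rw [MQuot.pnorm_mk]
  exact ae_weightedMeasure (L0.rep_proj _ _)

variable [Module ℝ M] [IsScalarTower ℝ (L0 (cap m)) M] [TopologicalSpace M]

/-- A rapidly Cauchy sequence of `M_m` converges: lift it to `M`, rescale the lift so that it is
uniformly Cauchy with respect to the capacity, take the limit in `M`, and undo the rescaling in
`M_m`, where this is possible since the factor is `m`-a.e. different from zero. -/
theorem exists_limit_of_tsum_ne_top [IsL0Module (cap m) A M] (hA : IsExhaustion m A) (v : ℕ → M)
    (hv : ∑' n, 2 ^ n * moduleDist m.toOuterMeasure A (MQuot.mk m (v (n + 1))) (MQuot.mk m (v n))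
      ≠ ∞) :
    ∃ y : MQuot m M,
      Tendsto (fun n => moduleDist m.toOuterMeasure A (MQuot.mk m (v n)) y) atTop (𝓝 0) := by
  have hAm : ∀ k, MeasurableSet (A k) := fun k => (hA.isOpen k).measurableSet
  have hv' : ∑' n, 2 ^ n * ∫⁻ x, ENNReal.ofReal
      (min ((pnorm (cap m) (v (n + 1) - v n)).rep x) 1) ∂weightedMeasure m A ≠ ∞ := by
    convert hv using 4 with n
    rw [moduleDist_eq_lintegral hAm]
    refine lintegral_congr_ae ?_
    filter_upwards [rep_pnorm_mk_sub (v (n + 1)) (v n)] with x hx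
    rw [hx]
  obtain ⟨f, hfm, hf0, hfle, hfne⟩ := exists_rescaling (fun n => L0.measurable_rep _) hv'
  set F : L0 (cap m) := L0.mk (cap m) f hfm with hF
  obtain ⟨w, hw⟩ := exists_limit_of_geometric hA (w := fun n => F • v n) fun n => by
    rw [← smul_sub]
    filter_upwards [rep_pnorm_smul F (v (n + 1) - v n), L0.rep_mk (μ := cap m) f hfm]
      with x h1 h2
    rw [h1, h2, abs_of_nonneg (hf0 x)]
    exact hfle n x
  set H : L0 m.toOuterMeasure := L0.mk m.toOuterMeasure (fun x => (f x)⁻¹) hfm.inv with hH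
  refine ⟨H • MQuot.mk m w, tendsto_moduleDist_of_rep_le hAm
    (g := fun n x => (f x)⁻¹ * (2 * (1 / 2) ^ n)) (fun n => ?_)
    (fun n => hfm.inv.mul_const _) (Eventually.of_forall fun x => ?_)⟩
  · set G : L0 m.toOuterMeasure := L0.mk m.toOuterMeasure f hfm with hG
    have hsplit : MQuot.mk m (v n) - H • MQuot.mk m w
        = H • (MQuot.mk m (F • v n) - MQuot.mk m w) + (1 - H * G) • MQuot.mk m (v n) := by
      rw [← MQuot.smul_mk, smul_sub, sub_smul, one_smul, mul_smul]
      abel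
    rw [hsplit]
    filter_upwards [ae_weightedMeasure (rep_pnorm_add_le (μ := m.toOuterMeasure)
        (H • (MQuot.mk m (F • v n) - MQuot.mk m w)) ((1 - H * G) • MQuot.mk m (v n))),
      ae_weightedMeasure (rep_pnorm_smul H (MQuot.mk m (F • v n) - MQuot.mk m w)),
      ae_weightedMeasure (rep_pnorm_smul (1 - H * G) (MQuot.mk m (v n))),
      ae_weightedMeasure (L0.rep_sub 1 (H * G)), ae_weightedMeasure (L0.rep_mul H G),
      ae_weightedMeasure (L0.rep_one (μ := m.toOuterMeasure)),
      ae_weightedMeasure (L0.rep_mk (μ := m.toOuterMeasure) (fun x => (f x)⁻¹) hfm.inv),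
      ae_weightedMeasure (L0.rep_mk (μ := m.toOuterMeasure) f hfm),
      rep_pnorm_mk_sub (F • v n) w, hw n, hfne] with x h1 h2 h3 h4 h5 h6 h7 h8 h9 h10 h11
    have h12 : (1 - H * G).rep x = 0 := by
      rw [h4, h5, h6, h7, h8, inv_mul_cancel₀ h11, sub_self]
    rw [h2, h3, h12, abs_zero, zero_mul, add_zero, h7, h9,
      abs_of_nonneg (inv_nonneg.2 (hf0 x))] at h1
    exact h1.trans (mul_le_mul_of_nonneg_left h10 (inv_nonneg.2 (hf0 x)))
  · simpa using (((tendsto_pow_atTop_nhds_zero_of_lt_one (r := (1 / 2 : ℝ)) (by norm_num)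
      (by norm_num)).const_mul 2).const_mul (f x)⁻¹)

/-- `M_m` is complete. -/
theorem MQuot.complete [IsL0Module (cap m) A M] (hA : IsExhaustion m A) (u : ℕ → MQuot m M)
    (hu : ∀ ε : ℝ≥0∞, 0 < ε → ∃ N, ∀ p ≥ N, ∀ q ≥ N,
      moduleDist m.toOuterMeasure A (u p) (u q) < ε) :
    ∃ y, Tendsto (fun n => moduleDist m.toOuterMeasure A (u n) y) atTop (𝓝 0) := by
  have hAm : ∀ k, MeasurableSet (A k) := fun k => (hA.isOpen k).measurableSet
  -- the rate `4⁻ⁿ` compensates the weights `2ⁿ`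
  obtain ⟨φ, hφ, hφu⟩ := extraction_forall_of_eventually
    (P := fun n k => ∀ p ≥ k, ∀ q ≥ k, moduleDist m.toOuterMeasure A (u p) (u q) < (4 ^ n)⁻¹)
    fun n => by
      obtain ⟨N, hN⟩ := hu (4 ^ n)⁻¹ (ENNReal.inv_pos.2 (by finiteness))
      exact eventually_atTop.2 ⟨N, fun k hk p hp q hq => hN p (hk.trans hp) q (hk.trans hq)⟩
  choose v hv using fun n => MQuot.mk_surjective m (u (φ n))
  obtain ⟨y, hy⟩ := exists_limit_of_tsum_ne_top hA v <| by
    refine ne_top_of_le_ne_top (tsum_two_pow_inv.trans_ne ENNReal.ofNat_ne_top)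
      (ENNReal.tsum_le_tsum fun n => ?_)
    rw [hv, hv]
    calc 2 ^ n * moduleDist m.toOuterMeasure A (u (φ (n + 1))) (u (φ n))
        ≤ 2 ^ n * (4 ^ n)⁻¹ := by
          gcongr
          exact (hφu n _ (hφ.monotone n.le_succ) _ le_rfl).le
      _ = (2 ^ n)⁻¹ := by
          rw [show (4 : ℝ≥0∞) = 2 * 2 by norm_num, mul_pow,
            ENNReal.mul_inv (Or.inl (by positivity)) (Or.inl (by finiteness)), ← mul_assoc,
            ENNReal.mul_inv_cancel (by positivity) (by finiteness), one_mul]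
  simp only [hv] at hy
  refine ⟨y, ENNReal.tendsto_atTop_zero.2 fun ε hε => ?_⟩
  obtain ⟨N, hN⟩ := hu (ε / 2) (ENNReal.half_pos hε.ne')
  obtain ⟨k, hk, hkN⟩ := ((hy.eventually_lt_const (ENNReal.half_pos hε.ne')).and
    (hφ.tendsto_atTop.eventually_ge_atTop N)).exists
  refine ⟨N, fun n hn => (moduleDist_triangle hAm _ (u (φ k)) _).trans ?_⟩
  rw [← ENNReal.add_halves ε]
  exact add_le_add (hN n hn _ hkN).le hk.le

end Complete

/-! ### The topology of an `L⁰(m)`-module -/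

section IsL0Module

variable {X : Type*} [MeasurableSpace X] {m : Measure X} {A : ℕ → Set X} {N : Type*}
  [AddCommGroup N] [Module ℝ N] [Module (L0 m.toOuterMeasure) N]
  [IsScalarTower ℝ (L0 m.toOuterMeasure) N] [PointwiseNorm m.toOuterMeasure N]

theorem rep_pnorm_real_smul (c : ℝ) (v : N) : ∀ᵐ x ∂m.toOuterMeasure,
    (pnorm m.toOuterMeasure (c • v)).rep x = |c| * (pnorm m.toOuterMeasure v).rep x := by
  rw [← algebraMap_smul (L0 m.toOuterMeasure) c v]
  filter_upwards [rep_pnorm_smul (algebraMap ℝ (L0 m.toOuterMeasure) c) v,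
    L0.rep_algebraMap (μ := m.toOuterMeasure) c] with x h1 h2
  rw [h1, h2]

theorem moduleDist_smul_le (hA : ∀ k, MeasurableSet (A k)) (c : ℝ) (v w : N) :
    moduleDist m.toOuterMeasure A (c • v) (c • w)
      ≤ ENNReal.ofReal (max |c| 1) * moduleDist m.toOuterMeasure A v w := by
  rw [moduleDist_eq_lintegral hA, moduleDist_eq_lintegral hA, ← smul_sub,
    ← lintegral_const_mul _ ((L0.measurable_rep _).min measurable_const).ennreal_ofReal]
  refine lintegral_mono_ae ?_
  filter_upwards [ae_weightedMeasure (rep_pnorm_real_smul c (v - w)),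
    ae_weightedMeasure (rep_pnorm_nonneg (μ := m.toOuterMeasure) (v - w))] with x h1 h2
  rw [← ENNReal.ofReal_mul (by positivity), h1, mul_min_of_nonneg _ _ (by positivity), mul_one]
  exact ENNReal.ofReal_le_ofReal
    (min_le_min (mul_le_mul_of_nonneg_right (le_max_left _ _) h2) (le_max_right _ _))

/-- For a measure, the topological vector space axioms follow from the other ones. -/
theorem isL0Module_topologyOfDist (hA : ∀ k, MeasurableSet (A k))
    (hc : ∀ u : ℕ → N, (∀ ε : ℝ≥0∞, 0 < ε → ∃ k, ∀ p ≥ k, ∀ q ≥ k,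
        moduleDist m.toOuterMeasure A (u p) (u q) < ε) →
      ∃ v, Tendsto (fun n => moduleDist m.toOuterMeasure A (u n) v) atTop (𝓝 0)) :
    letI : TopologicalSpace N := topologyOfDist (moduleDist m.toOuterMeasure A (M := N))
    IsL0Module m.toOuterMeasure A N := by
  let : TopologicalSpace N := topologyOfDist (moduleDist m.toOuterMeasure A (M := N))
  have hb : ∀ v : N, (𝓝 v).HasBasis (fun ε : ℝ≥0∞ => 0 < ε)
      fun ε => {w | moduleDist m.toOuterMeasure A v w < ε} :=
    hasBasis_nhds_topologyOfDist (moduleDist_self hA) (moduleDist_triangle hA)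
  -- convergence in the topology is convergence in distance
  have ht : ∀ {ι : Type _} {l : Filter ι} {u : ι → N} {v : N},
      Tendsto u l (𝓝 v) ↔
        Tendsto (fun i => moduleDist m.toOuterMeasure A v (u i)) l (𝓝 0) := by
    intro ι l u v
    rw [(hb v).tendsto_right_iff, ENNReal.nhds_zero_basis.tendsto_right_iff]
    rfl
  have hid : ∀ v : N, Tendsto (fun w => moduleDist m.toOuterMeasure A v w) (𝓝 v) (𝓝 0) :=
    fun v => ht.1 tendsto_id
  have hadd : ContinuousAdd N := ⟨continuous_iff_continuousAt.2 fun ⟨v, w⟩ => by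
    refine ht.2 (tendsto_of_tendsto_of_tendsto_of_le_of_le tendsto_const_nhds ?_
      (fun _ => zero_le) fun p => moduleDist_add_add_le hA v w p.1 p.2)
    have := ((hid v).comp (continuous_fst.tendsto (v, w))).add
      ((hid w).comp (continuous_snd.tendsto (v, w)))
    rwa [add_zero] at this⟩
  have hneg : ContinuousNeg N := ⟨continuous_iff_continuousAt.2 fun v => by
    refine ht.2 ((hid v).congr fun w => ?_)
    simp only [moduleDist, ← neg_sub', pnorm_neg]⟩
  have hsmul : ContinuousSMul ℝ N := ⟨continuous_iff_continuousAt.2 fun ⟨c, v⟩ => by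
    refine ht.2 (tendsto_of_tendsto_of_tendsto_of_le_of_le tendsto_const_nhds ?_
      (fun _ => zero_le) fun p => (moduleDist_triangle hA (c • v) (p.1 • v) (p.1 • p.2)).trans
        (add_le_add le_rfl (moduleDist_smul_le hA p.1 v p.2)))
    have h1 : Tendsto (fun a : ℝ => moduleDist m.toOuterMeasure A (c • v) (a • v)) (𝓝 c)
        (𝓝 0) := by
      refine tendsto_moduleDist_of_rep_le hA
        (g := fun a x => |c - a| * (pnorm m.toOuterMeasure v).rep x) (fun a => ?_)
        (fun a => (L0.measurable_rep _).const_mul _) (Eventually.of_forall fun x => ?_)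
      · rw [← sub_smul]
        filter_upwards [ae_weightedMeasure (rep_pnorm_real_smul (c - a) v)] with x hx
        exact hx.le
      · have : Continuous fun a : ℝ => |c - a| * (pnorm m.toOuterMeasure v).rep x := by fun_prop
        simpa using this.tendsto c
    have h2 : Tendsto (fun a : ℝ => ENNReal.ofReal (max |a| 1)) (𝓝 c)
        (𝓝 (ENNReal.ofReal (max |c| 1))) :=
      ENNReal.tendsto_ofReal (Continuous.tendsto (by fun_prop) c)
    have h3 := ENNReal.Tendsto.mul (h2.comp (continuous_fst.tendsto (c, v)))
      (Or.inr ENNReal.zero_ne_top) ((hid v).comp (continuous_snd.tendsto (c, v)))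
      (Or.inr ENNReal.ofReal_ne_top)
    have h4 := (h1.comp (continuous_fst.tendsto (c, v))).add h3
    rwa [mul_zero, add_zero] at h4⟩
  exact { isTopologicalAddGroup := { hadd, hneg with }
          continuousSMul := hsmul
          hasBasis := hb
          complete := hc }

theorem continuous_of_pnorm_map_le {P : Type*} [AddCommGroup P] [Module ℝ P]
    [Module (L0 m.toOuterMeasure) P] [IsScalarTower ℝ (L0 m.toOuterMeasure) P]
    [PointwiseNorm m.toOuterMeasure P] [TopologicalSpace P] [IsL0Module m.toOuterMeasure A P]
    [TopologicalSpace N] [IsL0Module m.toOuterMeasure A N] (hA : ∀ k, MeasurableSet (A k))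
    (S : P →ₗ[L0 m.toOuterMeasure] N)
    (hS : ∀ x, pnorm m.toOuterMeasure (S x) ≤ pnorm m.toOuterMeasure x) : Continuous S :=
  continuous_iff_continuousAt.2 fun x =>
    ((IsL0Module.hasBasis (μ := m.toOuterMeasure) (A := A) x).tendsto_iff
      (IsL0Module.hasBasis (μ := m.toOuterMeasure) (A := A) (S x))).2 fun ε hε =>
        ⟨ε, hε, fun y hy => (moduleDist_map_le hA S hS x y).trans_lt hy⟩

end IsL0Module

/-! ### Factorisation of linear maps through the quotient -/

section Factor

variable {X : Type*} [MetricSpace X] [MeasurableSpace X] [BorelSpace X] {m : Measure X}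
  {A : ℕ → Set X} {M : Type*} [AddCommGroup M] [Module (L0 (cap m)) M] [PointwiseNorm (cap m) M]
  [Module ℝ M] [IsScalarTower ℝ (L0 (cap m)) M]

/-- A linear map dominated by the pointwise norm is automatically `L⁰`-linear: for each rational
`q`, the defect `T (f v) - f T v` does not change when `f` is replaced by `f - q`, so that it is
bounded by `2 |f - q| |v|`; at almost every point `q` may be taken arbitrarily close to `f`. -/
theorem map_smul_of_pnorm_le {N : Type*} [AddCommGroup N] [Module ℝ N]
    [Module (L0 m.toOuterMeasure) N] [IsScalarTower ℝ (L0 m.toOuterMeasure) N]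
    [PointwiseNorm m.toOuterMeasure N] (T : M →ₗ[ℝ] N)
    (hT : ∀ v, pnorm m.toOuterMeasure (T v) ≤ Pr m (pnorm (cap m) v)) (f : L0 (cap m)) (v : M) :
    T (f • v) = Pr m f • T v := by
  rw [← sub_eq_zero]
  refine pnorm_eq_zero_of_rep_le (μ := m.toOuterMeasure) ?_
  have hT' : ∀ u, ∀ᵐ x ∂m.toOuterMeasure,
      (pnorm m.toOuterMeasure (T u)).rep x ≤ (pnorm (cap m) u).rep x := fun u => by
    filter_upwards [L0.le_iff_rep.1 (hT u), L0.rep_proj (ae_le_ae_cap m) (pnorm (cap m) u)]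
      with x h1 h2
    exact h1.trans_eq h2
  have hq : ∀ q : ℚ, ∀ᵐ x ∂m.toOuterMeasure,
      (pnorm m.toOuterMeasure (T (f • v) - Pr m f • T v)).rep x
        ≤ 2 * |f.rep x - q| * (pnorm (cap m) v).rep x := by
    intro q
    set g : L0 (cap m) := f - algebraMap ℝ (L0 (cap m)) q with hg
    have hPr : Pr m g = Pr m f - algebraMap ℝ (L0 m.toOuterMeasure) q := map_sub (Pr m) _ _
    have hdefect : T (f • v) - Pr m f • T v = T (g • v) + -(Pr m g • T v) := by
      rw [hPr, hg, sub_smul, sub_smul, algebraMap_smul, algebraMap_smul, map_sub, T.map_smul]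
      abel
    rw [hdefect]
    have h1 := rep_pnorm_add_le (μ := m.toOuterMeasure) (T (g • v)) (-(Pr m g • T v))
    rw [pnorm_neg (Pr m g • T v)] at h1
    filter_upwards [h1, hT' (g • v), hT' v, rep_pnorm_smul (Pr m g) (T v),
      ae_le_ae_cap m (rep_pnorm_smul g v), L0.rep_proj (ae_le_ae_cap m) g,
      ae_le_ae_cap m (L0.rep_sub f (algebraMap ℝ (L0 (cap m)) q)),
      ae_le_ae_cap m (L0.rep_algebraMap (μ := cap m) q)] with x h1 h2 h3 h4 h5 h6 h7 h8
    have h9 : g.rep x = f.rep x - q := by rw [← h8]; exact h7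
    have h6' : (Pr m g).rep x = g.rep x := h6
    rw [h5, h9] at h2
    rw [h4, h6', h9] at h1
    have := mul_le_mul_of_nonneg_left h3 (abs_nonneg (f.rep x - q))
    linarith
  filter_upwards [ae_all_iff.2 hq] with x hx
  have hcont : Continuous fun q : ℝ => 2 * |f.rep x - q| * (pnorm (cap m) v).rep x := by fun_prop
  have hall := Rat.isDenseEmbedding_coe_real.dense.induction
    (P := fun q => (pnorm m.toOuterMeasure (T (f • v) - Pr m f • T v)).rep x
      ≤ 2 * |f.rep x - q| * (pnorm (cap m) v).rep x)
    (by rintro _ ⟨q, rfl⟩; exact hx q) (isClosed_le continuous_const hcont)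
  simpa using hall (f.rep x)

theorem pnorm_prM (v : M) :
    pnorm m.toOuterMeasure (prM m M v) = Pr m (pnorm (cap m) v) :=
  MQuot.pnorm_mk m v

variable {N : Type*} [AddCommGroup N] [Module ℝ N] [Module (L0 m.toOuterMeasure) N]
  [IsScalarTower ℝ (L0 m.toOuterMeasure) N] [PointwiseNorm m.toOuterMeasure N]

omit [IsScalarTower ℝ (L0 (cap m)) M] [IsScalarTower ℝ (L0 m.toOuterMeasure) N] in
theorem map_eq_map_of_mk_eq_mk (T : M →ₗ[ℝ] N)
    (hT : ∀ v, pnorm m.toOuterMeasure (T v) ≤ Pr m (pnorm (cap m) v)) {v w : M}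
    (h : MQuot.mk m v = MQuot.mk m w) : T v = T w := by
  rw [← sub_eq_zero, ← map_sub, ← PointwiseNorm.pnorm_eq_zero_iff (μ := m.toOuterMeasure)]
  exact le_antisymm ((hT _).trans_eq ((MQuot.mk_eq_mk_iff m v w).1 h))
    (PointwiseNorm.pnorm_nonneg _)

/-- The map induced on `M_m` by a linear map `T` on `M` with `|T v| ≤ Pr |v|`. -/
def MQuot.lift (T : M →ₗ[ℝ] N)
    (hT : ∀ v, pnorm m.toOuterMeasure (T v) ≤ Pr m (pnorm (cap m) v)) :
    MQuot m M →ₗ[L0 m.toOuterMeasure] N where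
  toFun x := T (MQuot.mk_surjective m x).choose
  map_add' x y := by
    rw [← map_add]
    refine map_eq_map_of_mk_eq_mk T hT ?_
    rw [MQuot.mk_add]
    simp only [(MQuot.mk_surjective m _).choose_spec]
  map_smul' F x := by
    obtain ⟨f, hf, rfl⟩ := F.exists_mk
    have h := map_smul_of_pnorm_le T hT (L0.mk (cap m) f hf) (MQuot.mk_surjective m x).choose
    refine Eq.trans (map_eq_map_of_mk_eq_mk T hT ?_) h
    rw [← MQuot.smul_mk]
    simp only [(MQuot.mk_surjective m _).choose_spec]

theorem MQuot.lift_prM (T : M →ₗ[ℝ] N)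
    (hT : ∀ v, pnorm m.toOuterMeasure (T v) ≤ Pr m (pnorm (cap m) v)) (v : M) :
    MQuot.lift T hT (prM m M v) = T v :=
  map_eq_map_of_mk_eq_mk T hT (MQuot.mk_surjective m (MQuot.mk m v)).choose_spec

omit [IsScalarTower ℝ (L0 m.toOuterMeasure) N] in
/-- A factorising map does not increase the pointwise norm. -/
theorem pnorm_map_le_of_comp_prM {T : M →ₗ[ℝ] N}
    (hT : ∀ v, pnorm m.toOuterMeasure (T v) ≤ Pr m (pnorm (cap m) v)) {S : MQuot m M → N}
    (hS : ∀ v, S (prM m M v) = T v) (x : MQuot m M) :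
    pnorm m.toOuterMeasure (S x) ≤ pnorm m.toOuterMeasure x := by
  obtain ⟨v, rfl⟩ : ∃ v, prM m M v = x := MQuot.mk_surjective m x
  rw [hS, pnorm_prM]
  exact hT v

variable [TopologicalSpace (MQuot m M)] [IsL0Module m.toOuterMeasure A (MQuot m M)]

theorem hasNormedUniversalProperty_prM (hA : ∀ k, MeasurableSet (A k)) :
    HasNormedUniversalProperty.{w} m A (prM m M) := by
  refine ⟨fun N _ _ _ _ _ _ _ T hT => ?_, fun N _ _ _ _ _ _ _ T hT S hS x =>
    pnorm_map_le_of_comp_prM hT hS x⟩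
  refine ⟨⟨MQuot.lift T hT, continuous_of_pnorm_map_le (A := A) hA _
    (pnorm_map_le_of_comp_prM hT (MQuot.lift_prM T hT))⟩, MQuot.lift_prM T hT,
    fun S hS => ContinuousLinearMap.ext fun x => ?_⟩
  obtain ⟨v, rfl⟩ : ∃ v, prM m M v = x := MQuot.mk_surjective m x
  exact (hS v).trans (MQuot.lift_prM T hT v).symm

end Factor

/-! ### Uniqueness of the universal couple -/

section Uniqueness

variable {X : Type*} [MetricSpace X] [MeasurableSpace X] [BorelSpace X] {m : Measure X}
  {A : ℕ → Set X} {M : Type u} [AddCommGroup M] [Module (L0 (cap m)) M] [PointwiseNorm (cap m) M]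
  [Module ℝ M] [IsScalarTower ℝ (L0 (cap m)) M]
  [TopologicalSpace (MQuot m M)] [IsL0Module m.toOuterMeasure A (MQuot m M)]
  {M' : Type u} [AddCommGroup M'] [Module ℝ M'] [Module (L0 m.toOuterMeasure) M']
  [IsScalarTower ℝ (L0 m.toOuterMeasure) M'] [PointwiseNorm m.toOuterMeasure M']
  [TopologicalSpace M'] [IsL0Module m.toOuterMeasure A M'] {π' : M →ₗ[ℝ] M'}

/-- The comparison isomorphism: the two factorisations, of `π'` through `Pr_M` and of `Pr_M`
through `π'`, are inverse to each other. -/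
theorem exists_equiv_of_hasUniversalProperty (hA : ∀ k, MeasurableSet (A k))
    (hπ : ∀ v, pnorm m.toOuterMeasure (π' v) ≤ Pr m (pnorm (cap m) v))
    (hU : HasUniversalProperty.{u} m A π') :
    ∃ Φ : MQuot m M ≃L[L0 m.toOuterMeasure] M', ∀ v, Φ (prM m M v) = π' v := by
  obtain ⟨S, hS, -⟩ := (hasNormedUniversalProperty_prM.{u} hA).1 M' π' hπ
  obtain ⟨R, hR, -⟩ := hU (MQuot m M) (prM m M) fun v => (pnorm_prM v).le
  have hRS : ∀ x, R (S x) = x := fun x => by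
    obtain ⟨v, rfl⟩ : ∃ v, prM m M v = x := MQuot.mk_surjective m x
    rw [hS, hR]
  have hSR : S.comp R = ContinuousLinearMap.id (L0 m.toOuterMeasure) M' :=
    (hU M' π' hπ).unique (fun v => by rw [ContinuousLinearMap.comp_apply, hR, hS]) fun _ => rfl
  exact ⟨ContinuousLinearEquiv.equivOfInverse S R hRS fun y => DFunLike.congr_fun hSR y, hS⟩

omit [IsL0Module m.toOuterMeasure A (MQuot m M)] [IsScalarTower ℝ (L0 m.toOuterMeasure) M']
  [PointwiseNorm m.toOuterMeasure M'] [IsL0Module m.toOuterMeasure A M'] in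
theorem equiv_ext_of_comp_prM {Φ Ψ : MQuot m M ≃L[L0 m.toOuterMeasure] M'}
    (hΦ : ∀ v, Φ (prM m M v) = π' v) (hΨ : ∀ v, Ψ (prM m M v) = π' v) : Φ = Ψ := by
  ext x
  obtain ⟨v, rfl⟩ : ∃ v, prM m M v = x := MQuot.mk_surjective m x
  rw [hΦ, hΨ]

omit [IsScalarTower ℝ (L0 m.toOuterMeasure) M'] [IsL0Module m.toOuterMeasure A M'] in
/-- If the factorisations through `π'` do not increase the pointwise norm, then the comparison
isomorphism preserves it, since neither it nor its inverse increases it. -/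
theorem pnorm_equiv_of_hasNormedUniversalProperty
    (hπ : ∀ v, pnorm m.toOuterMeasure (π' v) ≤ Pr m (pnorm (cap m) v))
    (hU : HasNormedUniversalProperty.{u} m A π') {Φ : MQuot m M ≃L[L0 m.toOuterMeasure] M'}
    (hΦ : ∀ v, Φ (prM m M v) = π' v) (x : MQuot m M) :
    pnorm m.toOuterMeasure (Φ x) = pnorm m.toOuterMeasure x := by
  refine le_antisymm (pnorm_map_le_of_comp_prM hπ hΦ x) ?_
  have h := hU.2 (MQuot m M) (prM m M) (fun v => (pnorm_prM v).le)
    (Φ.symm : M' →L[L0 m.toOuterMeasure] MQuot m M) (fun v => by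
      rw [← hΦ]
      exact Φ.symm_apply_apply _) (Φ x)
  rwa [ContinuousLinearEquiv.coe_coe, Φ.symm_apply_apply] at h

end Uniqueness

end CapModule

end

theorem mainTheorem8
    {X : Type uX} [MetricSpace X] [CompleteSpace X] [TopologicalSpace.SeparableSpace X]
    [MeasurableSpace X] [BorelSpace X]
    (m : Measure X) (hm : ∀ (x : X) (r : ℝ), m (Metric.ball x r) < ∞)
    (A : ℕ → Set X) (hA : IsExhaustion m A)
    (M : Type u) [AddCommGroup M] [Module ℝ M] [Module (L0 (cap m)) M]
    [IsScalarTower ℝ (L0 (cap m)) M] [PointwiseNorm (cap m) M] [TopologicalSpace M]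
    [IsL0Module (cap m) A M] :
    letI : TopologicalSpace (MQuot m M) :=
      topologyOfDist (moduleDist m.toOuterMeasure A (M := MQuot m M))
    -- `M_m` is an `L⁰(m)`-module
    IsL0Module m.toOuterMeasure A (MQuot m M) ∧
    -- `(M_m, Pr_M)` has the universal property, and the factorising maps satisfy `|S x| ≤ |x|`
    HasNormedUniversalProperty.{w} m A (prM m M) ∧
    -- uniqueness of the couple
    ∀ (M' : Type u) [AddCommGroup M'] [Module ℝ M'] [Module (L0 m.toOuterMeasure) M']
      [IsScalarTower ℝ (L0 m.toOuterMeasure) M'] [PointwiseNorm m.toOuterMeasure M']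
      [TopologicalSpace M'] [IsL0Module m.toOuterMeasure A M'] (π' : M →ₗ[ℝ] M'),
      (∀ v, pnorm m.toOuterMeasure (π' v) ≤ Pr m (pnorm (cap m) v)) →
      (HasUniversalProperty.{u} m A π' →
        ∃! Φ : MQuot m M ≃L[L0 m.toOuterMeasure] M', ∀ v, Φ (prM m M v) = π' v) ∧
      (HasNormedUniversalProperty.{u} m A π' ∨
          (HasUniversalProperty.{u} m A π' ∧
            ∀ v, pnorm m.toOuterMeasure (π' v) = Pr m (pnorm (cap m) v)) →
        ∃! Φ : MQuot m M ≃L[L0 m.toOuterMeasure] M',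
          (∀ x, pnorm m.toOuterMeasure (Φ x) = pnorm m.toOuterMeasure x) ∧
            ∀ v, Φ (prM m M v) = π' v) := by
  let : TopologicalSpace (MQuot m M) :=
    topologyOfDist (moduleDist m.toOuterMeasure A (M := MQuot m M))
  have hAm : ∀ k, MeasurableSet (A k) := fun k => (hA.isOpen k).measurableSet
  have hL : IsL0Module m.toOuterMeasure A (MQuot m M) :=
    isL0Module_topologyOfDist hAm (MQuot.complete hA)
  refine ⟨hL, hasNormedUniversalProperty_prM hAm, fun M' _ _ _ _ _ _ _ π' hπ =>
    ⟨fun hU => ?_, fun h => ?_⟩⟩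
  · obtain ⟨Φ, hΦ⟩ := exists_equiv_of_hasUniversalProperty hAm hπ hU
    exact ⟨Φ, hΦ, fun Ψ hΨ => equiv_ext_of_comp_prM hΨ hΦ⟩
  · obtain ⟨Φ, hΦ⟩ := exists_equiv_of_hasUniversalProperty hAm hπ (h.elim And.left And.left)
    refine ⟨Φ, ⟨fun x => ?_, hΦ⟩, fun Ψ hΨ => equiv_ext_of_comp_prM hΨ.2 hΦ⟩
    rcases h with hU | ⟨-, hnorm⟩
    · exact pnorm_equiv_of_hasNormedUniversalProperty hπ hU hΦ x
    · obtain ⟨v, rfl⟩ : ∃ v, prM m M v = x := MQuot.mk_surjective m x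
      rw [hΦ, hnorm, pnorm_prM]
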